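/- For complex parameters write $${}_3F_2\!\left({a_1,a_2,a_3\atop b_1,b_2}\Big|\,z\right)=\sum_{n\ge0}\frac{(a_1)_n(a_2)_n(a_3)_n}{(b_1)_n(b_2)_n\,n!}\,z^n .$$ Let $$\Psi_4=\frac{x\,(2x^2-21x+56)^2(x^2-28)^4(x^2-7x+14)^4}{4\,(x^3-14x^2+56x-56)^7},$$ $$P_4=1-x+\tfrac14x^2-\tfrac1{56}x^3,\qquad Q_4=\bigl(1-\tfrac1{28}x^2\bigr)\bigl(1-\tfrac12x+\tfrac1{14}x^2\bigr),$$ $$R_1=1-\tfrac38x+\tfrac1{28}x^2,\qquad R_2=1-\tfrac{33}{32}x+\tfrac{13}{32}x^2-\tfrac9{128}x^3+\tfrac1{224}x^4,$$ $$K_1=\Bigl(\tfrac12\sqrt{R_1R_2}+\tfrac12-\tfrac{45}{128}x+\tfrac5{64}x^2-\tfrac5{896}x^3\Bigr)^{1/4},\qquad K_2=\left(\frac{\sqrt{R_1R_2}-1+\frac{45}{64}x-\frac5{32}x^2+\frac5{448}x^3}{\frac{625}{57344}\,x^2}\right)^{1/4},$$ where here and below all roots and fractional powers are principal branches. Near $x=0$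 their bases are close to $1$ (the base of $K_2$ has a removable singularity at $x=0$, with value $1$ there), so $K_1$ and $K_2$ are $1+O(x)$. (a) The functions $${}_3F_2\!\left({-\frac3{28},\frac1{28},\frac9{28}\atop\frac14,\,\frac12}\Big|z\right),\quad z^{1/2}\,{}_3F_2\!\left({\frac{11}{28},\frac{15}{28},\frac{23}{28}\atop\frac34,\,\frac32}\Big|z\right),\quad z^{3/4}\,{}_3F_2\!\left({\frac9{14},\frac{11}{14},\frac{15}{14}\atop\frac54,\,\frac74}\Big|z\right)$$ are holomorphic solutions, on the unit disc cut along $(-1,0]$, of the same hypergeometric equation $$\Bigl(z\tfrac{d}{dz}+\alpha_1\Bigr)\Bigl(z\tfrac{d}{dz}+\alpha_2\Bigr)\Bigl(z\tfrac{d}{dz}+\alpha_3\Bigr)Y=\tfrac{d}{dz}\Bigl(z\tfrac{d}{dz}+\beta_1-1\Bigr)\Bigl(z\tfrac{d}{dz}+\beta_2-1\Bigr)Y$$ with $(\alpha_1,\alpha_2,\alpha_3)=(-\frac3{28},\frac1{28},\frac9{28})$ and $(\beta_1,\beta_2)=(\frac14,\frac12)$; that is, the three ${}_3F_2$-functions are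 companions. Moreover the parameter systems $(\frac9{14},\frac{11}{14},\frac{15}{14};\frac54,\frac74)$ and $(\frac1{14},\frac9{14},\frac{11}{14};\frac34,\frac54)$ are contiguous to $(-\frac3{14},\frac1{14},\frac9{14};\frac14,\frac34)$: after reordering the upper and the lower parameters, corresponding parameters differ by integers. (b) The following identities hold for all complex $x$ in a neighborhood of $0$ (in the second one, for $x\neq0$; there the right-hand side has a removable singularity at $x=0$): $${}_3F_2\!\left({-\frac3{28},\frac1{28},\frac9{28}\atop\frac14,\,\frac12}\Big|\Psi_4\right)=\frac{\frac12\sqrt{R_1R_2}+\frac12-\frac{15}{32}x+\frac{53}{448}x^2-\frac1{112}x^3}{P_4^{3/4}K_1},$$ $${}_3F_2\!\left({\frac{11}{28},\frac{15}{28},\frac{23}{28}\atop\frac34,\,\frac32}\Big|\Psi_4\right)=\frac{P_4^{11/4}}{Q_4^2R_1}\cdot\frac{\sqrt{R_1R_2}-1+\frac{15}{16}x-\frac{53}{224}x^2+\frac1{56}x^3}{\frac{15}{64}\,x\,K_2},$$ $${}_3F_2\!\left({\frac9{14},\frac{11}{14},\frac{15}{14}\atop\frac54,\,\frac74}\Big|\Psi_4\right)=\frac{P_4^{9/2}}{Q_4^3R_1^{3/2}}\Bigl(1-\tfrac3{14}x\Bigr),$$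 $${}_3F_2\!\left({\frac1{14},\frac9{14},\frac{11}{14}\atop\frac34,\,\frac54}\Big|\Psi_4\right)=\frac{\sqrt{P_4}}{Q_4\sqrt{R_1}}\Bigl(1-\tfrac35x+\tfrac18x^2-\tfrac1{112}x^3\Bigr),$$ $${}_3F_2\!\left({-\frac3{14},\frac1{14},\frac9{14}\atop\frac14,\,\frac34}\Big|\Psi_4\right)=\frac{\sqrt{R_1}}{P_4^{3/2}}\Bigl(1-\tfrac34x+\tfrac14x^2-\tfrac3{112}x^3\Bigr).$$ -/

import Mathlib

open Filter Topology

noncomputable section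

namespace HypergeometricDarboux

/-- The generalized hypergeometric function `₃F₂(a₀, a₁, a₂; b₀, b₁ | z)`, as the sum of its defining
power series `∑ (a₀)ₙ (a₁)ₙ (a₂)ₙ / ((b₀)ₙ (b₁)ₙ n!) zⁿ`, where `(c)ₙ = c (c+1) ⋯ (c+n-1)`. -/
def hyp3F2 (a : Fin 3 → ℂ) (b : Fin 2 → ℂ) (z : ℂ) : ℂ :=
  ∑' n : ℕ, (∏ i, (ascPochhammer ℂ n).eval (a i)) /
    ((∏ j, (ascPochhammer ℂ n).eval (b j)) * (n.factorial : ℂ)) * z ^ n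

/-- The operator `z d/dz + c`. -/
def eulerOp (c : ℂ) (y : ℂ → ℂ) : ℂ → ℂ := fun z => z * deriv y z + c * y z

/-- `y` is a holomorphic solution on the open set `U` of the third order hypergeometric equation
`(z d/dz + a₀)(z d/dz + a₁)(z d/dz + a₂) y = d/dz (z d/dz + b₀ - 1)(z d/dz + b₁ - 1) y`. -/
def IsHypSolutionOn (a : Fin 3 → ℂ) (b : Fin 2 → ℂ) (U : Set ℂ) (y : ℂ → ℂ) : Prop :=
  DifferentiableOn ℂ y U ∧
    ∀ z ∈ U, eulerOp (a 0) (eulerOp (a 1) (eulerOp (a 2) y)) z =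
      deriv (eulerOp (b 0 - 1) (eulerOp (b 1 - 1) y)) z

/-- The open unit disc cut along `(-1, 0]`. -/
def slitDisc : Set ℂ := {z | ‖z‖ < 1 ∧ z ∈ Complex.slitPlane}

/-- Two parameter systems of `₃F₂` are contiguous: up to the order of the upper parameters and the
order of the lower parameters, corresponding parameters differ by integers. -/
def Contiguous (a : Fin 3 → ℂ) (b : Fin 2 → ℂ) (a' : Fin 3 → ℂ) (b' : Fin 2 → ℂ) : Prop :=
  (∃ σ : Equiv.Perm (Fin 3), ∀ i, ∃ m : ℤ, a' (σ i) = a i + m) ∧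
    (∃ τ : Equiv.Perm (Fin 2), ∀ j, ∃ m : ℤ, b' (τ j) = b j + m)

/-- The degree 21 covering `Ψ₄`. -/
def Psi₄ (x : ℂ) : ℂ :=
  x * (2 * x ^ 2 - 21 * x + 56) ^ 2 * (x ^ 2 - 28) ^ 4 * (x ^ 2 - 7 * x + 14) ^ 4 /
    (4 * (x ^ 3 - 14 * x ^ 2 + 56 * x - 56) ^ 7)

def P₄ (x : ℂ) : ℂ := 1 - x + 1 / 4 * x ^ 2 - 1 / 56 * x ^ 3

def Q₄ (x : ℂ) : ℂ := (1 - 1 / 28 * x ^ 2) * (1 - 1 / 2 * x + 1 / 14 * x ^ 2)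

def R₁ (x : ℂ) : ℂ := 1 - 3 / 8 * x + 1 / 28 * x ^ 2

def R₂ (x : ℂ) : ℂ :=
  1 - 33 / 32 * x + 13 / 32 * x ^ 2 - 9 / 128 * x ^ 3 + 1 / 224 * x ^ 4

/-- `√(R₁ R₂)`: the principal square root, which is the branch with value `1` at `x = 0`. -/
def sqrtR (x : ℂ) : ℂ := (R₁ x * R₂ x) ^ (1 / 2 : ℂ)

/-- The base of the fourth root is `1` at `x = 0`, so near `0` this is the branch `1 + O(x)`. -/
def K₁ (x : ℂ) : ℂ :=
  (1 / 2 * sqrtR x + 1 / 2 - 45 / 128 * x + 5 / 64 * x ^ 2 - 5 / 896 * x ^ 3) ^ (1 / 4 : ℂ)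

/-- The base of the fourth root has a removable singularity at `x = 0` with limit `1`, so on a
punctured neighborhood of `0` this is the branch `1 + O(x)`; the formula is meant for `x ≠ 0`. -/
def K₂ (x : ℂ) : ℂ :=
  ((sqrtR x - 1 + 45 / 64 * x - 5 / 32 * x ^ 2 + 5 / 448 * x ^ 3) /
    (625 / 57344 * x ^ 2)) ^ (1 / 4 : ℂ)

end HypergeometricDarboux

end

open HypergeometricDarboux

/-!
The function `₃F₂` and two functions contiguous to it satisfy a first order linear system in `z`.
Pulled back along `Ψ₄`, it becomes a system in `x` with a regular singular point at `x = 0`, and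
among the germs meromorphic at `0` its solution is unique up to a constant: an order comparison
shows that a solution cannot vanish to positive order. The explicit radical expressions solve the
pulled back system, which is verified by taking logarithmic derivatives, and they have the correct
value at `x = 0`. The dihedral expressions are treated in the same way over the double covering
`w² = R₁ R₂`: the branch `w = √(R₁ R₂)` gives the first evaluation, the branch `w = -√(R₁ R₂)`
together with a factor `Ψ₄ ^ (-1 / 2)` gives its companion.
-/

noncomputable section

namespace HypergeometricDarboux

/-- The sum of the power series with coefficients `c`. -/
def powSum (c : ℕ → ℂ) (z : ℂ) : ℂ := ∑' n : ℕ, c n * z ^ n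

/-- The power series with coefficients `c` converges on the open unit disc. -/
def ConvergesOnDisc (c : ℕ → ℂ) : Prop := ∀ z : ℂ, ‖z‖ < 1 → Summable fun n => c n * z ^ n

theorem powSum_zero (c : ℕ → ℂ) : powSum c 0 = c 0 := by
  rw [powSum, tsum_eq_single 0 fun n hn => by rw [zero_pow hn, mul_zero], pow_zero, mul_one]

theorem powSum_const_mul (k : ℂ) (c : ℕ → ℂ) (z : ℂ) :
    powSum (fun n => k * c n) z = k * powSum c z := by
  simp only [powSum, mul_assoc, tsum_mul_left]

namespace ConvergesOnDisc

variable {c : ℕ → ℂ} {z : ℂ}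

theorem exists_summable_majorant (hc : ConvergesOnDisc c) (hz : ‖z‖ < 1) :
    ∃ r : ℝ, z ∈ Metric.ball (0 : ℂ) r ∧ Summable (fun n => ‖c n‖ * r ^ n) ∧
      ∀ (n : ℕ) (w : ℂ), w ∈ Metric.ball (0 : ℂ) r → ‖c n * w ^ n‖ ≤ ‖c n‖ * r ^ n := by
  obtain ⟨r, hzr, hr1⟩ := exists_between hz
  have hr : ‖(r : ℂ)‖ = r := Complex.norm_of_nonneg ((norm_nonneg z).trans hzr.le)
  refine ⟨r, mem_ball_zero_iff.2 hzr, ?_, fun n w hw => ?_⟩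
  · simpa only [norm_mul, norm_pow, hr] using (hc r (hr.trans_lt hr1)).norm
  · rw [norm_mul, norm_pow]
    gcongr
    exact (mem_ball_zero_iff.1 hw).le

theorem differentiableAt (hc : ConvergesOnDisc c) (hz : ‖z‖ < 1) :
    DifferentiableAt ℂ (powSum c) z := by
  obtain ⟨r, hzr, hs, hb⟩ := hc.exists_summable_majorant hz
  exact (Complex.differentiableOn_tsum_of_summable_norm hs (fun n => by fun_prop)
    Metric.isOpen_ball hb).differentiableAt (Metric.isOpen_ball.mem_nhds hzr)

theorem analyticAt (hc : ConvergesOnDisc c) (hz : ‖z‖ < 1) : AnalyticAt ℂ (powSum c) z := by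
  have hball : DifferentiableOn ℂ (powSum c) (Metric.ball 0 1) := fun w hw =>
    (hc.differentiableAt (mem_ball_zero_iff.1 hw)).differentiableWithinAt
  exact hball.analyticAt (Metric.isOpen_ball.mem_nhds (mem_ball_zero_iff.2 hz))

theorem hasSum_deriv (hc : ConvergesOnDisc c) (hz : ‖z‖ < 1) :
    HasSum (fun n : ℕ => (n + 1) * c (n + 1) * z ^ n) (deriv (powSum c) z) := by
  obtain ⟨r, hzr, hs, hb⟩ := hc.exists_summable_majorant hz
  have h := Complex.hasSum_deriv_of_summable_norm hs (fun n => by fun_prop) Metric.isOpen_ball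
    hb hzr
  have hterm (n : ℕ) : deriv (fun w => c n * w ^ n) z = c n * (n * z ^ (n - 1)) :=
    ((hasDerivAt_pow n z).const_mul (c n)).deriv
  rw [← hasSum_nat_add_iff' 1] at h
  simp only [hterm, Finset.sum_range_one, Nat.cast_zero, zero_mul, mul_zero, sub_zero,
    Nat.add_sub_cancel, Nat.cast_succ] at h
  exact h.congr_fun fun n => by ring

theorem deriv_powSum (hc : ConvergesOnDisc c) (hz : ‖z‖ < 1) :
    deriv (powSum c) z = powSum (fun n => (n + 1) * c (n + 1)) z :=
  (hc.hasSum_deriv hz).tsum_eq.symm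

theorem hasSum_eulerOp (hc : ConvergesOnDisc c) (d : ℂ) (hz : ‖z‖ < 1) :
    HasSum (fun n : ℕ => (n + d) * c n * z ^ n) (eulerOp d (powSum c) z) := by
  have h : HasSum (fun n : ℕ => n * c n * z ^ n) (z * deriv (powSum c) z) := by
    rw [← hasSum_nat_add_iff' 1]
    simp only [Finset.sum_range_one, Nat.cast_zero, zero_mul, sub_zero, Nat.cast_succ]
    exact ((hc.hasSum_deriv hz).mul_left z).congr_fun fun n => by ring
  exact (h.add ((hc z hz).hasSum.mul_left d)).congr_fun fun n => by ring

theorem mul_add (hc : ConvergesOnDisc c) (d : ℂ) : ConvergesOnDisc fun n => (n + d) * c n :=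
  fun _ hz => (hc.hasSum_eulerOp d hz).summable

theorem eulerOp_powSum (hc : ConvergesOnDisc c) (d : ℂ) (hz : ‖z‖ < 1) :
    eulerOp d (powSum c) z = powSum (fun n => (n + d) * c n) z :=
  (hc.hasSum_eulerOp d hz).tsum_eq.symm

theorem powSum_eq_add_mul (hc : ConvergesOnDisc c) (hz : ‖z‖ < 1) :
    powSum c z = c 0 + z * powSum (fun n => c (n + 1)) z := by
  rw [powSum, (hc z hz).tsum_eq_zero_add, pow_zero, mul_one, powSum, ← tsum_mul_left]
  exact congrArg _ (tsum_congr fun n => by ring)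

end ConvergesOnDisc

theorem isOpen_slitDisc : IsOpen slitDisc :=
  (isOpen_lt continuous_norm continuous_const).inter Complex.isOpen_slitPlane

theorem eqOn_eulerOp {U : Set ℂ} (hU : IsOpen U) {f g : ℂ → ℂ} (h : Set.EqOn f g U) (d : ℂ) :
    Set.EqOn (eulerOp d f) (eulerOp d g) U := fun z hz => by
  rw [eulerOp, eulerOp, (h.eventuallyEq_of_mem (hU.mem_nhds hz)).deriv_eq, h hz]

section Frobenius

variable {c : ℕ → ℂ} {z : ℂ}

theorem hasDerivAt_cpow_mul_powSum (hc : ConvergesOnDisc c) (s : ℂ) (hz : z ∈ slitDisc) :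
    HasDerivAt (fun z => z ^ s * powSum c z)
      (s * z ^ (s - 1) * powSum c z + z ^ s * deriv (powSum c) z) z := by
  have hpow : HasDerivAt (fun z : ℂ => z ^ s) (s * z ^ (s - 1)) z := by
    simpa only [id_eq, mul_one] using (hasDerivAt_id z).cpow_const (c := s) hz.2
  exact hpow.fun_mul (hc.differentiableAt hz.1).hasDerivAt

theorem eulerOp_cpow_mul_powSum (hc : ConvergesOnDisc c) (s d : ℂ) :
    Set.EqOn (eulerOp d fun z => z ^ s * powSum c z)
      (fun z => z ^ s * powSum (fun n => (n + (s + d)) * c n) z) slitDisc := fun z hz => by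
  have hz0 : z ≠ 0 := Complex.slitPlane_ne_zero hz.2
  dsimp only
  rw [eulerOp, (hasDerivAt_cpow_mul_powSum hc s hz).deriv,
    ← hc.eulerOp_powSum (s + d) hz.1, eulerOp,
    Complex.cpow_sub _ _ hz0, Complex.cpow_one]
  field_simp
  ring

theorem eulerOp_eulerOp_eulerOp_cpow_mul_powSum (hc : ConvergesOnDisc c) (s d₀ d₁ d₂ : ℂ) :
    Set.EqOn (eulerOp d₀ (eulerOp d₁ (eulerOp d₂ fun z => z ^ s * powSum c z)))
      (fun z => z ^ s * powSum
        (fun n => (n + (s + d₀)) * ((n + (s + d₁)) * ((n + (s + d₂)) * c n))) z) slitDisc := by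
  have h₂ := eulerOp_cpow_mul_powSum hc s d₂
  have h₁ := (eqOn_eulerOp isOpen_slitDisc h₂ d₁).trans
    (eulerOp_cpow_mul_powSum (hc.mul_add _) s d₁)
  exact (eqOn_eulerOp isOpen_slitDisc h₁ d₀).trans
    (eulerOp_cpow_mul_powSum ((hc.mul_add _).mul_add _) s d₀)

theorem isHypSolutionOn_cpow_mul_powSum {a : Fin 3 → ℂ} {b : Fin 2 → ℂ} {s : ℂ}
    (hc : ConvergesOnDisc c) (indicial : s * ((s + b 0 - 1) * (s + b 1 - 1)) = 0)
    (recurrence : ∀ n : ℕ, (n + 1 + s) * ((n + s + b 0) * (n + s + b 1)) * c (n + 1) =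
      (n + s + a 0) * (n + s + a 1) * (n + s + a 2) * c n) :
    IsHypSolutionOn a b slitDisc fun z => z ^ s * powSum c z := by
  refine ⟨fun z hz => (hasDerivAt_cpow_mul_powSum hc s hz).differentiableAt.differentiableWithinAt,
    fun z hz => mul_left_cancel₀ (Complex.slitPlane_ne_zero hz.2) ?_⟩
  have hderiv (f : ℂ → ℂ) : z * deriv f z = eulerOp 0 f z := by rw [eulerOp, zero_mul, add_zero]
  rw [hderiv, eulerOp_eulerOp_eulerOp_cpow_mul_powSum hc s _ _ _ hz,
    eulerOp_eulerOp_eulerOp_cpow_mul_powSum hc s _ _ _ hz]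
  dsimp only
  rw [(((hc.mul_add _).mul_add _).mul_add _).powSum_eq_add_mul (z := z) (c := fun n : ℕ =>
    (n + (s + 0)) * ((n + (s + (b 0 - 1))) * ((n + (s + (b 1 - 1))) * c n))) hz.1]
  have hconst : ((0 : ℕ) + (s + 0)) * (((0 : ℕ) + (s + (b 0 - 1))) *
      (((0 : ℕ) + (s + (b 1 - 1))) * c 0)) = 0 := by
    push_cast
    linear_combination c 0 * indicial
  have hshift : (fun n : ℕ => ((n + 1 : ℕ) + (s + 0)) * (((n + 1 : ℕ) + (s + (b 0 - 1))) *
      (((n + 1 : ℕ) + (s + (b 1 - 1))) * c (n + 1)))) =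
      fun n : ℕ => (n + (s + a 0)) * ((n + (s + a 1)) * ((n + (s + a 2)) * c n)) := by
    funext n
    push_cast
    linear_combination recurrence n
  rw [hconst, hshift]
  ring

end Frobenius

section Hypergeometric

theorem vecCons_add_single_zero {n : ℕ} (c : ℂ) (v : Fin n → ℂ) :
    Matrix.vecCons c v + Pi.single 0 1 = Matrix.vecCons (c + 1) v := by
  ext i
  cases i using Fin.cases <;> simp

theorem vecCons_add_single_one {n : ℕ} (c d : ℂ) (v : Fin n → ℂ) :
    Matrix.vecCons c (Matrix.vecCons d v) + Pi.single 1 1 =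
      Matrix.vecCons c (Matrix.vecCons (d + 1) v) := by
  ext j
  cases j using Fin.cases with
  | zero => simp
  | succ j => cases j using Fin.cases <;> simp [Fin.succ_succ_ne_one]

theorem ascPochhammer_eval_add_one (x : ℂ) (n : ℕ) :
    x * (ascPochhammer ℂ n).eval (x + 1) = (n + x) * (ascPochhammer ℂ n).eval x := by
  have h : (ascPochhammer ℂ (n + 1)).eval x = x * (ascPochhammer ℂ n).eval (x + 1) := by
    rw [ascPochhammer_succ_left, Polynomial.eval_mul, Polynomial.eval_X, Polynomial.eval_comp,
      Polynomial.eval_add, Polynomial.eval_X, Polynomial.eval_one]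
  rw [← h, ascPochhammer_succ_eval]
  ring

/-- The coefficients of the power series defining `₃F₂`. -/
def hypCoeff (a : Fin 3 → ℂ) (b : Fin 2 → ℂ) (n : ℕ) : ℂ :=
  (∏ i, (ascPochhammer ℂ n).eval (a i)) /
    ((∏ j, (ascPochhammer ℂ n).eval (b j)) * (n.factorial : ℂ))

variable (a : Fin 3 → ℂ) (b : Fin 2 → ℂ)

theorem hyp3F2_eq_powSum : hyp3F2 a b = powSum (hypCoeff a b) := rfl

theorem hypCoeff_zero : hypCoeff a b 0 = 1 := by simp [hypCoeff]

theorem hyp3F2_zero : hyp3F2 a b 0 = 1 := by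
  rw [hyp3F2_eq_powSum, powSum_zero, hypCoeff_zero]

theorem hyp3F2_comp_perm (σ : Equiv.Perm (Fin 3)) (τ : Equiv.Perm (Fin 2)) :
    hyp3F2 (a ∘ σ) (b ∘ τ) = hyp3F2 a b := by
  funext z
  refine tsum_congr fun n => ?_
  rw [← Equiv.prod_comp σ fun i => (ascPochhammer ℂ n).eval (a i),
    ← Equiv.prod_comp τ fun j => (ascPochhammer ℂ n).eval (b j)]
  rfl

theorem hyp3F2_rotate (a₀ a₁ a₂ : ℂ) : hyp3F2 ![a₁, a₂, a₀] b = hyp3F2 ![a₀, a₁, a₂] b := by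
  rw [← hyp3F2_comp_perm ![a₀, a₁, a₂] b (finRotate 3) 1]
  congr 1
  ext i
  fin_cases i <;> rfl

theorem hyp3F2_swap (b₀ b₁ : ℂ) : hyp3F2 a ![b₁, b₀] = hyp3F2 a ![b₀, b₁] := by
  rw [← hyp3F2_comp_perm a ![b₀, b₁] 1 (Equiv.swap 0 1)]
  congr 1
  ext j
  fin_cases j <;> rfl

theorem hyp3F2_add_single_zero (a₀ a₁ a₂ b₀ b₁ : ℂ) :
    hyp3F2 (![a₀, a₁, a₂] + Pi.single 0 1) (![b₀, b₁] + Pi.single 0 1) =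
      hyp3F2 ![a₁, a₂, a₀ + 1] ![b₁, b₀ + 1] := by
  rw [vecCons_add_single_zero, vecCons_add_single_zero, ← hyp3F2_rotate, hyp3F2_swap]

theorem hyp3F2_add_single_zero_add_single_one (a₀ a₁ a₂ b₀ b₁ : ℂ) :
    hyp3F2 (![a₀, a₁, a₂] + Pi.single 0 1 + Pi.single 1 1)
      (![b₀, b₁] + Pi.single 0 1 + Pi.single 1 1) =
      hyp3F2 ![a₂, a₀ + 1, a₁ + 1] ![b₀ + 1, b₁ + 1] := by
  rw [vecCons_add_single_zero, vecCons_add_single_zero, vecCons_add_single_one,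
    vecCons_add_single_one, hyp3F2_rotate]

theorem hypCoeff_succ_eq_mul (n : ℕ) : hypCoeff a b (n + 1) =
    (∏ i, (a i + n)) / ((∏ j, (b j + n)) * (n + 1)) * hypCoeff a b n := by
  simp only [hypCoeff, ascPochhammer_succ_eval, Finset.prod_mul_distrib, Nat.factorial_succ,
    Nat.cast_mul, Nat.cast_succ, div_eq_mul_inv, mul_inv]
  ring

theorem tendsto_hypCoeff_ratio :
    Tendsto (fun n : ℕ => (∏ i, (a i + n)) / ((∏ j, (b j + n)) * (n + 1))) atTop (𝓝 (1 : ℂ)) := by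
  have h (p q : ℂ) : Tendsto (fun n : ℕ => (p + n) / (q + n)) atTop (𝓝 1) := by
    simpa only [one_mul, div_one] using
      tendsto_add_mul_div_add_mul_atTop_nhds p q (1 : ℂ) one_ne_zero
  have hprod := ((h (a 0) (b 0)).mul (h (a 1) (b 1))).mul (h (a 2) 1)
  simp only [mul_one] at hprod
  refine hprod.congr fun n => ?_
  rw [Fin.prod_univ_three, Fin.prod_univ_two, div_mul_div_comm, div_mul_div_comm, add_comm (1 : ℂ)]

theorem convergesOnDisc_hypCoeff : ConvergesOnDisc (hypCoeff a b) := fun z hz => by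
  obtain ⟨r, hzr, hr1⟩ := exists_between hz
  have hlim := ((tendsto_hypCoeff_ratio a b).mul_const z).norm
  rw [one_mul] at hlim
  refine summable_of_ratio_norm_eventually_le hr1 ?_
  filter_upwards [hlim.eventually_le_const hzr] with n hn
  calc ‖hypCoeff a b (n + 1) * z ^ (n + 1)‖
      = ‖(∏ i, (a i + n)) / ((∏ j, (b j + n)) * (n + 1)) * z‖ * ‖hypCoeff a b n * z ^ n‖ := by
        rw [hypCoeff_succ_eq_mul, ← norm_mul, pow_succ', mul_mul_mul_comm]
    _ ≤ r * ‖hypCoeff a b n * z ^ n‖ := by gcongr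

variable {a b}

theorem hypCoeff_succ (hb : ∀ j (n : ℕ), b j + n ≠ 0) (n : ℕ) :
    (n + 1) * (∏ j, (b j + n)) * hypCoeff a b (n + 1) = (∏ i, (a i + n)) * hypCoeff a b n := by
  have hn : (n : ℂ) + 1 ≠ 0 := n.cast_add_one_ne_zero
  have hprod : ∏ j, (b j + n) ≠ 0 := Finset.prod_ne_zero_iff.2 fun j _ => hb j n
  rw [hypCoeff_succ_eq_mul]
  field_simp

theorem isHypSolutionOn_cpow_mul_hyp3F2 {a a' : Fin 3 → ℂ} {b b' : Fin 2 → ℂ} {s : ℂ}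
    (ha' : ∀ i, a' i = a i + s) (hb' : ∀ j (n : ℕ), b' j + n ≠ 0)
    (h : ∀ t, t * (t + b' 0 - 1) * (t + b' 1 - 1) =
      (t + s) * (t + s + b 0 - 1) * (t + s + b 1 - 1)) :
    IsHypSolutionOn a b slitDisc fun z => z ^ s * hyp3F2 a' b' z := by
  refine isHypSolutionOn_cpow_mul_powSum (c := hypCoeff a' b')
    (convergesOnDisc_hypCoeff a' b') ?_ fun n => ?_
  · linear_combination -h 0
  · have hrec := hypCoeff_succ (a := a') hb' n
    simp only [Fin.prod_univ_three, Fin.prod_univ_two, ha'] at hrec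
    linear_combination hrec - hypCoeff a' b' (n + 1) * h (n + 1)

variable {z : ℂ}

theorem analyticAt_hyp3F2 (hz : ‖z‖ < 1) : AnalyticAt ℂ (hyp3F2 a b) z :=
  (convergesOnDisc_hypCoeff a b).analyticAt hz

theorem prod_eval_ascPochhammer_add_single {ι : Type*} [Fintype ι] [DecidableEq ι] (c : ι → ℂ)
    (i : ι) (n : ℕ) :
    c i * ∏ k, (ascPochhammer ℂ n).eval ((c + Pi.single i 1 : ι → ℂ) k) =
      (n + c i) * ∏ k, (ascPochhammer ℂ n).eval (c k) := by
  have hrest (k : ι) (hk : k ∈ Finset.univ.erase i) : (c + Pi.single i 1 : ι → ℂ) k = c k := by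
    rw [Pi.add_apply, Pi.single_eq_of_ne (Finset.ne_of_mem_erase hk), add_zero]
  rw [← Finset.mul_prod_erase _ _ (Finset.mem_univ i),
    ← Finset.mul_prod_erase _ _ (Finset.mem_univ i), ← mul_assoc, ← mul_assoc,
    Finset.prod_congr rfl fun k hk => by rw [hrest k hk], Pi.add_apply, Pi.single_eq_same,
    ascPochhammer_eval_add_one]

theorem eulerOp_hyp3F2_upper (i : Fin 3) (hz : ‖z‖ < 1) :
    eulerOp (a i) (hyp3F2 a b) z = a i * hyp3F2 (a + Pi.single i 1) b z := by
  rw [hyp3F2_eq_powSum, (convergesOnDisc_hypCoeff a b).eulerOp_powSum _ hz, hyp3F2_eq_powSum,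
    ← powSum_const_mul]
  congr 1
  funext n
  rw [hypCoeff, hypCoeff, ← mul_div_assoc, ← mul_div_assoc, prod_eval_ascPochhammer_add_single]

theorem eulerOp_hyp3F2_lower (j : Fin 2) (hb : ∀ n : ℕ, b j + n ≠ 0) (hz : ‖z‖ < 1) :
    eulerOp (b j) (hyp3F2 a (b + Pi.single j 1)) z = b j * hyp3F2 a b z := by
  rw [hyp3F2_eq_powSum, (convergesOnDisc_hypCoeff a _).eulerOp_powSum _ hz, hyp3F2_eq_powSum,
    ← powSum_const_mul]
  congr 1
  funext n
  have hbj : b j ≠ 0 := by simpa only [Nat.cast_zero, add_zero] using hb 0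
  have hbn : n + b j ≠ 0 := by simpa only [add_comm] using hb n
  have h := prod_eval_ascPochhammer_add_single b j n
  rw [mul_comm, ← eq_div_iff hbj] at h
  rw [hypCoeff, hypCoeff, h, ← mul_div_assoc, ← mul_div_assoc]
  field_simp

theorem deriv_hyp3F2 (hz : ‖z‖ < 1) :
    deriv (hyp3F2 a b) z = (∏ i, a i) / (∏ j, b j) * hyp3F2 (a + 1) (b + 1) z := by
  rw [hyp3F2_eq_powSum, (convergesOnDisc_hypCoeff a b).deriv_powSum hz, hyp3F2_eq_powSum,
    ← powSum_const_mul]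
  congr 1
  funext n
  have hn : (n : ℂ) + 1 ≠ 0 := n.cast_add_one_ne_zero
  have hpoch (x : ℂ) : (ascPochhammer ℂ (n + 1)).eval x = x * (ascPochhammer ℂ n).eval (x + 1) := by
    rw [ascPochhammer_succ_eval, mul_comm _ (x + n), add_comm x, ascPochhammer_eval_add_one]
  simp only [hypCoeff, hpoch, Finset.prod_mul_distrib, Nat.factorial_succ, Nat.cast_mul,
    Nat.cast_succ, Pi.add_apply, Pi.one_apply]
  rw [div_mul_div_comm, mul_div_assoc']
  field_simp

end Hypergeometric

section Pullback

/-- The pullback of `z d/dz + c` along `z = Ψ(x)`. -/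
def pullOp (Ψ : ℂ → ℂ) (c : ℂ) (y : ℂ → ℂ) : ℂ → ℂ := fun x =>
  deriv y x / logDeriv Ψ x + c * y x

variable {Ψ f g : ℂ → ℂ} {c x x₀ : ℂ}

theorem pullOp_comp (hΨ : deriv Ψ x ≠ 0) (hf : DifferentiableAt ℂ f (Ψ x)) (c : ℂ) :
    pullOp Ψ c (f ∘ Ψ) x = eulerOp c f (Ψ x) := by
  rw [pullOp, deriv_comp x hf (differentiableAt_of_deriv_ne_zero hΨ), logDeriv_apply, eulerOp,
    Function.comp_apply, div_div_eq_mul_div]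
  field_simp

theorem meromorphicAt_pullOp (hf : MeromorphicAt f x₀) (hΨ : MeromorphicAt Ψ x₀) (c : ℂ) :
    MeromorphicAt (pullOp Ψ c f) x₀ :=
  (hf.deriv.div (hΨ.deriv.div hΨ)).add ((MeromorphicAt.const c x₀).mul hf)

theorem pullOp_sub (hf : DifferentiableAt ℂ f x) (hg : DifferentiableAt ℂ g x) (c : ℂ) :
    pullOp Ψ c (f - g) x = pullOp Ψ c f x - pullOp Ψ c g x := by
  rw [pullOp, pullOp, pullOp, deriv_sub hf hg, Pi.sub_apply]
  ring

theorem tendsto_sub_mul_logDeriv {n : ℤ} (hf : MeromorphicAt f x₀)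
    (hn : meromorphicOrderAt f x₀ = n) :
    Tendsto (fun x => (x - x₀) * logDeriv f x) (𝓝[≠] x₀) (𝓝 n) := by
  obtain ⟨k, hk, hk0, hfk⟩ := (meromorphicOrderAt_eq_int_iff hf).1 hn
  have hlim : Tendsto (fun x => n + (x - x₀) * logDeriv k x) (𝓝[≠] x₀) (𝓝 n) := by
    have hcont : ContinuousAt (fun x => n + (x - x₀) * logDeriv k x) x₀ := by
      have := (hk.deriv.div hk hk0).continuousAt
      simp only [logDeriv]
      fun_prop
    simpa only [sub_self, zero_mul, add_zero] using hcont.tendsto.mono_left nhdsWithin_le_nhds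
  refine hlim.congr' ?_
  filter_upwards [logDeriv_congr_nhdsNE hfk, self_mem_nhdsWithin,
    (hk.continuousAt.eventually_ne hk0).filter_mono nhdsWithin_le_nhds,
    hk.eventually_analyticAt.filter_mono nhdsWithin_le_nhds] with x hx hne hkx hka
  have hx₀ : x - x₀ ≠ 0 := sub_ne_zero.2 hne
  simp only [smul_eq_mul] at hx
  have hpow : logDeriv (fun x => (x - x₀) ^ n) x = n / (x - x₀) := by
    rw [logDeriv_fun_zpow (by fun_prop), logDeriv_apply, deriv_sub_const_fun, deriv_id'',
      mul_one_div]
  rw [hx, logDeriv_mul (f := fun x => (x - x₀) ^ n) x (zpow_ne_zero n hx₀) hkx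
    ((by fun_prop : DifferentiableAt ℂ (· - x₀) x).zpow (.inl hx₀)) hka.differentiableAt, hpow]
  field_simp

/-- `Ψ` is holomorphic at `x₀` with a simple zero there, i.e. a local coordinate. -/
structure IsSimpleZero (Ψ : ℂ → ℂ) (x₀ : ℂ) : Prop where
  analyticAt : AnalyticAt ℂ Ψ x₀
  eq_zero : Ψ x₀ = 0
  deriv_ne_zero : deriv Ψ x₀ ≠ 0

theorem meromorphicOrderAt_pullOp (hΨ : IsSimpleZero Ψ x₀) (hf : MeromorphicAt f x₀)
    (hc : ∀ n : ℤ, meromorphicOrderAt f x₀ = n → (n : ℂ) + c ≠ 0) :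
    meromorphicOrderAt (pullOp Ψ c f) x₀ = meromorphicOrderAt f x₀ := by
  obtain htop | ⟨n, hn⟩ : meromorphicOrderAt f x₀ = ⊤ ∨ ∃ n : ℤ, meromorphicOrderAt f x₀ = n := by
    cases h : meromorphicOrderAt f x₀ <;> simp
  · have hf0 : f =ᶠ[𝓝[≠] x₀] 0 := meromorphicOrderAt_eq_top_iff.1 htop
    rw [htop, meromorphicOrderAt_eq_top_iff]
    filter_upwards [hf0, hf0.nhdsNE_deriv] with x hx hdx
    simp only [Pi.zero_apply, deriv_zero] at hx hdx
    rw [pullOp, hx, hdx]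
    simp
  · have hfactor : pullOp Ψ c f =ᶠ[𝓝[≠] x₀] f * fun x =>
        (x - x₀) * logDeriv f x / ((x - x₀) * logDeriv Ψ x) + c := by
      filter_upwards [self_mem_nhdsWithin, (meromorphicOrderAt_ne_top_iff_eventually_ne_zero hf).1
        (hn ▸ WithTop.coe_ne_top)] with x hx hfx
      rw [pullOp, Pi.mul_apply, mul_div_mul_left _ _ (sub_ne_zero.2 hx), logDeriv_apply f]
      field_simp
    have hlim := ((tendsto_sub_mul_logDeriv hf hn).div
      (hΨ.analyticAt.tendsto_mul_logDeriv_simple_zero hΨ.eq_zero hΨ.deriv_ne_zero)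
      one_ne_zero).add_const c
    rw [div_one] at hlim
    have hmero : MeromorphicAt (fun x =>
        (x - x₀) * logDeriv f x / ((x - x₀) * logDeriv Ψ x) + c) x₀ := by
      have := hΨ.analyticAt.meromorphicAt
      simp only [logDeriv]
      fun_prop
    rw [meromorphicOrderAt_congr hfactor, meromorphicOrderAt_mul hf hmero,
      (tendsto_ne_zero_iff_meromorphicOrderAt_eq_zero hmero).1 ⟨_, hc n hn, hlim⟩, add_zero]

end Pullback

section Contiguity

open Complex (integerComplement)

/-- The pullback along `z = Ψ(x)`, at the point `x`, of the first order system satisfied by the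
contiguous functions `₃F₂(a; b)`, `₃F₂(a + e₀; b + e₀)` and `₃F₂(a + e₀ + e₁; b + e₀ + e₁)`, where
`eᵢ` denotes the `i`-th unit vector. -/
structure IsContiguitySystemAt (Ψ : ℂ → ℂ) (a : Fin 3 → ℂ) (b : Fin 2 → ℂ) (Y₀ Y₁ Y₂ : ℂ → ℂ)
    (x : ℂ) : Prop where
  pullOp_zero : b 0 * b 1 * pullOp Ψ 0 Y₀ x = a 0 * a 1 * (Ψ x * pullOp Ψ (a 2) Y₂ x)
  pullOp_one : a 0 * pullOp Ψ (b 0) Y₁ x = b 0 * pullOp Ψ (a 0) Y₀ x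
  pullOp_two : a 1 * pullOp Ψ (b 1) Y₂ x = b 1 * pullOp Ψ (a 1) Y₁ x

variable {Ψ : ℂ → ℂ} {a : Fin 3 → ℂ} {b : Fin 2 → ℂ} {x x₀ z : ℂ}

theorem eulerOp_hyp3F2_add_single (i : Fin 3) (j : Fin 2) (hb : ∀ n : ℕ, b j + n ≠ 0)
    (hz : ‖z‖ < 1) :
    a i * eulerOp (b j) (hyp3F2 (a + Pi.single i 1) (b + Pi.single j 1)) z =
      b j * eulerOp (a i) (hyp3F2 a b) z := by
  rw [eulerOp_hyp3F2_lower j hb hz, eulerOp_hyp3F2_upper i hz]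
  ring

theorem eulerOp_zero_hyp3F2 (hb : ∀ j, b j ≠ 0) (hz : ‖z‖ < 1) :
    b 0 * b 1 * eulerOp 0 (hyp3F2 a b) z = a 0 * a 1 * (z * eulerOp (a 2)
      (hyp3F2 (a + Pi.single 0 1 + Pi.single 1 1) (b + Pi.single 0 1 + Pi.single 1 1)) z) := by
  have ha : a + Pi.single 0 1 + Pi.single 1 1 + Pi.single 2 1 = a + 1 := by
    ext i
    fin_cases i <;> simp
  have hb' : b + Pi.single 0 1 + Pi.single 1 1 = b + 1 := by
    ext j
    fin_cases j <;> simp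
  have h₂ : (a + Pi.single 0 1 + Pi.single 1 1 : Fin 3 → ℂ) 2 = a 2 := by simp
  rw [← h₂, eulerOp_hyp3F2_upper 2 hz, ha, hb', h₂, eulerOp, deriv_hyp3F2 hz,
    Fin.prod_univ_three, Fin.prod_univ_two]
  have := hb 0
  have := hb 1
  field_simp
  ring

theorem isContiguitySystemAt_hyp3F2_comp (hb : ∀ j (n : ℕ), b j + n ≠ 0) (hΨ : deriv Ψ x ≠ 0)
    (hx : ‖Ψ x‖ < 1) :
    IsContiguitySystemAt Ψ a b (hyp3F2 a b ∘ Ψ)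
      (hyp3F2 (a + Pi.single 0 1) (b + Pi.single 0 1) ∘ Ψ)
      (hyp3F2 (a + Pi.single 0 1 + Pi.single 1 1) (b + Pi.single 0 1 + Pi.single 1 1) ∘ Ψ) x := by
  have hcomp {a : Fin 3 → ℂ} {b : Fin 2 → ℂ} (c : ℂ) :
      pullOp Ψ c (hyp3F2 a b ∘ Ψ) x = eulerOp c (hyp3F2 a b) (Ψ x) :=
    pullOp_comp hΨ (analyticAt_hyp3F2 hx).differentiableAt c
  have ha₁ : (a + Pi.single 0 1 : Fin 3 → ℂ) 1 = a 1 := by simp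
  have hb₁ : (b + Pi.single 0 1 : Fin 2 → ℂ) 1 = b 1 := by simp
  refine ⟨?_, ?_, ?_⟩ <;> rw [hcomp, hcomp]
  · exact eulerOp_zero_hyp3F2 (fun j => by simpa using hb j 0) hx
  · exact eulerOp_hyp3F2_add_single 0 0 (hb 0) hx
  · rw [← ha₁, ← hb₁]
    exact eulerOp_hyp3F2_add_single 1 1 (hb₁ ▸ hb 1) hx

theorem IsContiguitySystemAt.sub {Y₀ Y₁ Y₂ Z₀ Z₁ Z₂ : ℂ → ℂ}
    (hY : IsContiguitySystemAt Ψ a b Y₀ Y₁ Y₂ x) (hZ : IsContiguitySystemAt Ψ a b Z₀ Z₁ Z₂ x)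
    (hY₀ : DifferentiableAt ℂ Y₀ x) (hY₁ : DifferentiableAt ℂ Y₁ x)
    (hY₂ : DifferentiableAt ℂ Y₂ x) (hZ₀ : DifferentiableAt ℂ Z₀ x)
    (hZ₁ : DifferentiableAt ℂ Z₁ x) (hZ₂ : DifferentiableAt ℂ Z₂ x) :
    IsContiguitySystemAt Ψ a b (Y₀ - Z₀) (Y₁ - Z₁) (Y₂ - Z₂) x := by
  refine ⟨?_, ?_, ?_⟩ <;> simp only [pullOp_sub hY₀ hZ₀, pullOp_sub hY₁ hZ₁, pullOp_sub hY₂ hZ₂]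
  · linear_combination hY.pullOp_zero - hZ.pullOp_zero
  · linear_combination hY.pullOp_one - hZ.pullOp_one
  · linear_combination hY.pullOp_two - hZ.pullOp_two

theorem meromorphicOrderAt_const_mul {k : ℂ} (hk : k ≠ 0) (f : ℂ → ℂ) :
    meromorphicOrderAt (fun x => k * f x) x₀ = meromorphicOrderAt f x₀ :=
  meromorphicOrderAt_mul_of_ne_zero (g := fun _ => k) analyticAt_const hk

theorem meromorphicOrderAt_eq_of_pullOp (hΨ : IsSimpleZero Ψ x₀) {f g : ℂ → ℂ} {c d k l : ℂ}
    (hf : MeromorphicAt f x₀) (hg : MeromorphicAt g x₀) (hc : c ∈ integerComplement)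
    (hd : d ∈ integerComplement) (hk : k ≠ 0) (hl : l ≠ 0)
    (h : ∀ᶠ x in 𝓝[≠] x₀, k * pullOp Ψ c f x = l * pullOp Ψ d g x) :
    meromorphicOrderAt f x₀ = meromorphicOrderAt g x₀ := by
  have hne {c : ℂ} (hc : c ∈ integerComplement) (n : ℤ) : (n : ℂ) + c ≠ 0 := by
    rw [add_comm]
    exact Complex.integerComplement_add_ne_zero hc n
  rw [← meromorphicOrderAt_pullOp hΨ hf fun n _ => hne hc n,
    ← meromorphicOrderAt_pullOp hΨ hg fun n _ => hne hd n,
    ← meromorphicOrderAt_const_mul hk (pullOp Ψ c f),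
    ← meromorphicOrderAt_const_mul hl (pullOp Ψ d g)]
  exact meromorphicOrderAt_congr h

theorem IsSimpleZero.meromorphicOrderAt_eq_one (hΨ : IsSimpleZero Ψ x₀) :
    meromorphicOrderAt Ψ x₀ = 1 := by
  rw [← Function.id_comp Ψ, meromorphicOrderAt_comp_of_deriv_ne_zero hΨ.analyticAt
    hΨ.deriv_ne_zero, hΨ.eq_zero, meromorphicOrderAt_id]

/-- The last two relations of the system give the three functions the same order at `x₀`, while the
first one makes the order of `D₀` exceed that of `D₂` by one: all orders are infinite. -/
theorem IsContiguitySystemAt.eventuallyEq_zero (hΨ : IsSimpleZero Ψ x₀)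
    (ha : ∀ i, a i ∈ integerComplement) (hb : ∀ j, b j ∈ integerComplement) {D₀ D₁ D₂ : ℂ → ℂ}
    (hD₀ : MeromorphicAt D₀ x₀) (hD₁ : MeromorphicAt D₁ x₀) (hD₂ : MeromorphicAt D₂ x₀)
    (hlim : Tendsto D₀ (𝓝[≠] x₀) (𝓝 0))
    (h : ∀ᶠ x in 𝓝[≠] x₀, IsContiguitySystemAt Ψ a b D₀ D₁ D₂ x) :
    D₀ =ᶠ[𝓝[≠] x₀] 0 ∧ D₁ =ᶠ[𝓝[≠] x₀] 0 ∧ D₂ =ᶠ[𝓝[≠] x₀] 0 := by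
  have ha' (i : Fin 3) : a i ≠ 0 := Complex.integerComplement.ne_zero (ha i)
  have hb' (j : Fin 2) : b j ≠ 0 := Complex.integerComplement.ne_zero (hb j)
  have h₁₀ : meromorphicOrderAt D₁ x₀ = meromorphicOrderAt D₀ x₀ :=
    meromorphicOrderAt_eq_of_pullOp hΨ hD₁ hD₀ (hb 0) (ha 0) (ha' 0) (hb' 0)
      (h.mono fun _ hx => hx.pullOp_one)
  have h₂₁ : meromorphicOrderAt D₂ x₀ = meromorphicOrderAt D₁ x₀ :=
    meromorphicOrderAt_eq_of_pullOp hΨ hD₂ hD₁ (hb 1) (ha 1) (ha' 1) (hb' 1)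
      (h.mono fun _ hx => hx.pullOp_two)
  have hpos : 0 < meromorphicOrderAt D₀ x₀ :=
    (tendsto_zero_iff_meromorphicOrderAt_pos hD₀).1 hlim
  have h₀₂ : meromorphicOrderAt D₀ x₀ = 1 + meromorphicOrderAt D₂ x₀ := by
    have hpull : meromorphicOrderAt (pullOp Ψ 0 D₀) x₀ = meromorphicOrderAt D₀ x₀ :=
      meromorphicOrderAt_pullOp hΨ hD₀ fun n hn => by
        rw [hn] at hpos
        norm_cast at hpos ⊢
        omega
    rw [← hpull, ← hΨ.meromorphicOrderAt_eq_one,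
      ← meromorphicOrderAt_pullOp hΨ hD₂ fun n _ => add_comm (n : ℂ) (a 2) ▸
        Complex.integerComplement_add_ne_zero (ha 2) n,
      ← meromorphicOrderAt_const_mul (mul_ne_zero (hb' 0) (hb' 1)) (pullOp Ψ 0 D₀),
      ← meromorphicOrderAt_mul hΨ.analyticAt.meromorphicAt
        (meromorphicAt_pullOp hD₂ hΨ.analyticAt.meromorphicAt _),
      ← meromorphicOrderAt_const_mul (mul_ne_zero (ha' 0) (ha' 1)) (Ψ * _)]
    exact meromorphicOrderAt_congr (h.mono fun _ hx => hx.pullOp_zero)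
  have htop : meromorphicOrderAt D₀ x₀ = ⊤ := by
    rw [h₂₁, h₁₀] at h₀₂
    cases hn : meromorphicOrderAt D₀ x₀ with
    | top => rfl
    | coe n =>
      rw [hn] at h₀₂
      norm_cast at h₀₂
      omega
  simp only [← meromorphicOrderAt_eq_top_iff, EventuallyEq, Pi.zero_apply]
  exact ⟨htop, h₁₀.trans htop, h₂₁.trans (h₁₀.trans htop)⟩

theorem IsContiguitySystemAt.eventuallyEq_hyp3F2_comp (hΨ : IsSimpleZero Ψ x₀)
    (ha : ∀ i, a i ∈ integerComplement) (hb : ∀ j, b j ∈ integerComplement) {Y₀ Y₁ Y₂ : ℂ → ℂ}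
    (hY₀ : MeromorphicAt Y₀ x₀) (hY₁ : MeromorphicAt Y₁ x₀) (hY₂ : MeromorphicAt Y₂ x₀)
    (hlim : Tendsto Y₀ (𝓝[≠] x₀) (𝓝 1))
    (h : ∀ᶠ x in 𝓝[≠] x₀, IsContiguitySystemAt Ψ a b Y₀ Y₁ Y₂ x) :
    Y₀ =ᶠ[𝓝[≠] x₀] hyp3F2 a b ∘ Ψ ∧
    Y₁ =ᶠ[𝓝[≠] x₀] hyp3F2 (a + Pi.single 0 1) (b + Pi.single 0 1) ∘ Ψ ∧
    Y₂ =ᶠ[𝓝[≠] x₀] hyp3F2 (a + Pi.single 0 1 + Pi.single 1 1)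
      (b + Pi.single 0 1 + Pi.single 1 1) ∘ Ψ := by
  have hΨ₀ : ‖Ψ x₀‖ < 1 := by simp [hΨ.eq_zero]
  have hcomp (a : Fin 3 → ℂ) (b : Fin 2 → ℂ) : AnalyticAt ℂ (hyp3F2 a b ∘ Ψ) x₀ :=
    (analyticAt_hyp3F2 hΨ₀).comp hΨ.analyticAt
  have hlim' : Tendsto (Y₀ - hyp3F2 a b ∘ Ψ) (𝓝[≠] x₀) (𝓝 0) := by
    have hF : Tendsto (hyp3F2 a b ∘ Ψ) (𝓝[≠] x₀) (𝓝 1) := by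
      simpa only [Function.comp_apply, hΨ.eq_zero, hyp3F2_zero] using
        (hcomp a b).continuousAt.tendsto.mono_left nhdsWithin_le_nhds
    rw [← sub_self (1 : ℂ)]
    exact hlim.sub hF
  have hb' (j : Fin 2) (n : ℕ) : b j + n ≠ 0 := by
    exact_mod_cast Complex.integerComplement_add_ne_zero (hb j) n
  have hsystem := h.and <| (hΨ.analyticAt.eventually_analyticAt.and <|
    (hΨ.analyticAt.continuousAt.norm.eventually_lt continuousAt_const hΨ₀).and <|
    (hΨ.analyticAt.deriv.continuousAt.eventually_ne hΨ.deriv_ne_zero)).filter_mono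
      nhdsWithin_le_nhds
  have hdiff := IsContiguitySystemAt.eventuallyEq_zero hΨ ha hb
    (hY₀.sub (hcomp a b).meromorphicAt) (hY₁.sub (hcomp _ _).meromorphicAt)
    (hY₂.sub (hcomp _ _).meromorphicAt) hlim' <| by
    filter_upwards [hsystem, hY₀.eventually_analyticAt, hY₁.eventually_analyticAt,
      hY₂.eventually_analyticAt] with x hx h₀ h₁ h₂
    obtain ⟨hx, hΨx, hlt, hderiv⟩ := hx
    have hF (a : Fin 3 → ℂ) (b : Fin 2 → ℂ) : DifferentiableAt ℂ (hyp3F2 a b ∘ Ψ) x :=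
      ((analyticAt_hyp3F2 hlt).comp hΨx).differentiableAt
    exact hx.sub (isContiguitySystemAt_hyp3F2_comp hb' hderiv hlt) h₀.differentiableAt
      h₁.differentiableAt h₂.differentiableAt (hF _ _) (hF _ _) (hF _ _)
  exact ⟨eventuallyEq_iff_sub.2 hdiff.1, eventuallyEq_iff_sub.2 hdiff.2.1,
    eventuallyEq_iff_sub.2 hdiff.2.2⟩

end Contiguity

section LogarithmicDerivative

/-- `f` is differentiable at `x` with derivative `f x * l`; when `f x ≠ 0` this says that `l` is the
logarithmic derivative of `f` at `x`. -/
def HasLogDerivAt {𝕜 : Type*} [NontriviallyNormedField 𝕜] (f : 𝕜 → 𝕜) (l x : 𝕜) : Prop :=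
  HasDerivAt f (f x * l) x

theorem hasLogDerivAt_of_differentiableAt {𝕜 : Type*} [NontriviallyNormedField 𝕜] {f : 𝕜 → 𝕜}
    {x : 𝕜} (hf : DifferentiableAt 𝕜 f x) (hx : f x ≠ 0) : HasLogDerivAt f (logDeriv f x) x := by
  rw [HasLogDerivAt, logDeriv_apply, mul_div_cancel₀ _ hx]
  exact hf.hasDerivAt

namespace HasLogDerivAt

variable {𝕜 : Type*} [NontriviallyNormedField 𝕜] {f g : 𝕜 → 𝕜} {l m x : 𝕜}

theorem logDeriv_eq (hf : HasLogDerivAt f l x) (hx : f x ≠ 0) : logDeriv f x = l := by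
  rw [logDeriv_apply, HasDerivAt.deriv hf, mul_div_cancel_left₀ _ hx]

theorem congr_logDeriv (hf : HasLogDerivAt f l x) (h : l = m) : HasLogDerivAt f m x := h ▸ hf

theorem const_mul (hf : HasLogDerivAt f l x) (k : 𝕜) : HasLogDerivAt (fun x => k * f x) l x :=
  (HasDerivAt.const_mul k hf).congr_deriv (mul_assoc _ _ _).symm

theorem mul (hf : HasLogDerivAt f l x) (hg : HasLogDerivAt g m x) :
    HasLogDerivAt (fun x => f x * g x) (l + m) x :=
  (HasDerivAt.fun_mul hf hg).congr_deriv (by ring)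

theorem pow (hf : HasLogDerivAt f l x) (n : ℕ) : HasLogDerivAt (fun x => f x ^ n) (n * l) x := by
  refine (HasDerivAt.fun_pow hf n).congr_deriv ?_
  cases n with
  | zero => simp
  | succ n =>
    rw [Nat.add_sub_cancel]
    ring

theorem inv (hf : HasLogDerivAt f l x) (hx : f x ≠ 0) :
    HasLogDerivAt (fun x => (f x)⁻¹) (-l) x := by
  refine (HasDerivAt.fun_inv hf hx).congr_deriv ?_
  field_simp

theorem div (hf : HasLogDerivAt f l x) (hg : HasLogDerivAt g m x) (hx : g x ≠ 0) :
    HasLogDerivAt (fun x => f x / g x) (l - m) x := by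
  simp only [div_eq_mul_inv, sub_eq_add_neg]
  exact hf.mul (hg.inv hx)

theorem cpow_const {f : ℂ → ℂ} {l x : ℂ} (hf : HasLogDerivAt f l x)
    (hx : f x ∈ Complex.slitPlane) (c : ℂ) : HasLogDerivAt (fun x => f x ^ c) (c * l) x := by
  refine (HasDerivAt.cpow_const hf hx).congr_deriv ?_
  have := Complex.slitPlane_ne_zero hx
  rw [Complex.cpow_sub _ _ this, Complex.cpow_one]
  field_simp

variable {Ψ ρ f A B w : ℂ → ℂ} {x f' A' B' α β δ σ : ℂ}

theorem pullOp_mul {l : ℂ} (hρ : HasLogDerivAt ρ l x) (hf : HasDerivAt f f' x) (c : ℂ) :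
    pullOp Ψ c (fun x => ρ x * f x) x =
      ρ x * ((f' + l * f x) / logDeriv Ψ x + c * f x) := by
  rw [pullOp, (HasDerivAt.fun_mul hρ hf).deriv]
  ring

theorem pullOp_mul_add_mul (hρ : HasLogDerivAt ρ (α + β * w x + σ * logDeriv Ψ x) x)
    (hA : HasDerivAt A A' x) (hB : HasDerivAt B B' x) (hw : HasLogDerivAt w δ x)
    (hΨ : logDeriv Ψ x ≠ 0) (c : ℂ) :
    pullOp Ψ (c - σ) (fun x => ρ x * (A x + B x * w x)) x = ρ x *
      ((A' + α * A x + β * w x ^ 2 * B x) / logDeriv Ψ x + c * A x +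
        ((B' + (α + δ) * B x + β * A x) / logDeriv Ψ x + c * B x) * w x) := by
  rw [hρ.pullOp_mul (hA.fun_add (HasDerivAt.fun_mul hB hw))]
  field_simp
  ring

end HasLogDerivAt

theorem pullOp_const_mul (Ψ f : ℂ → ℂ) (c k x : ℂ) :
    pullOp Ψ c (fun x => k * f x) x = k * pullOp Ψ c f x := by
  rw [pullOp, pullOp, deriv_const_mul_field]
  ring

theorem pullOp_self_mul {Ψ f : ℂ → ℂ} {x : ℂ} (hΨ : logDeriv Ψ x ≠ 0)
    (hf : DifferentiableAt ℂ f x) (c : ℂ) :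
    pullOp Ψ c (fun x => Ψ x * f x) x = Ψ x * pullOp Ψ (c + 1) f x := by
  have hΨ' := div_ne_zero_iff.1 hΨ
  rw [(hasLogDerivAt_of_differentiableAt (differentiableAt_of_deriv_ne_zero hΨ'.1)
    hΨ'.2).pullOp_mul hf.hasDerivAt, pullOp]
  field_simp
  ring

end LogarithmicDerivative

section Covering

theorem hasDerivAt_of_eq_quartic {𝕜 : Type*} [NontriviallyNormedField 𝕜] {f : 𝕜 → 𝕜}
    (c₀ c₁ c₂ c₃ c₄ : 𝕜) (hf : ∀ x, f x = c₀ + c₁ * x + c₂ * x ^ 2 + c₃ * x ^ 3 + c₄ * x ^ 4)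
    (x : 𝕜) : HasDerivAt f (c₁ + 2 * c₂ * x + 3 * c₃ * x ^ 2 + 4 * c₄ * x ^ 3) x := by
  rw [funext hf]
  have h := ((((hasDerivAt_const x c₀).fun_add ((hasDerivAt_id' x).const_mul c₁)).fun_add
    ((hasDerivAt_pow 2 x).const_mul c₂)).fun_add ((hasDerivAt_pow 3 x).const_mul c₃)).fun_add
    ((hasDerivAt_pow 4 x).const_mul c₄)
  refine h.congr_deriv ?_
  push_cast
  ring

@[fun_prop]
theorem differentiable_P₄ : Differentiable ℂ P₄ := by
  unfold P₄
  fun_prop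

@[fun_prop]
theorem differentiable_Q₄ : Differentiable ℂ Q₄ := by
  unfold Q₄
  fun_prop

@[fun_prop]
theorem differentiable_R₁ : Differentiable ℂ R₁ := by
  unfold R₁
  fun_prop

@[fun_prop]
theorem differentiable_R₂ : Differentiable ℂ R₂ := by
  unfold R₂
  fun_prop

@[simp] theorem P₄_zero : P₄ 0 = 1 := by simp [P₄]

@[simp] theorem Q₄_zero : Q₄ 0 = 1 := by simp [Q₄]

@[simp] theorem R₁_zero : R₁ 0 = 1 := by simp [R₁]

@[simp] theorem R₂_zero : R₂ 0 = 1 := by simp [R₂]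

theorem logDeriv_eq_of_eq_quartic {f : ℂ → ℂ} (c₀ c₁ c₂ c₃ c₄ : ℂ)
    (hf : ∀ x, f x = c₀ + c₁ * x + c₂ * x ^ 2 + c₃ * x ^ 3 + c₄ * x ^ 4) (x : ℂ) :
    logDeriv f x = (c₁ + 2 * c₂ * x + 3 * c₃ * x ^ 2 + 4 * c₄ * x ^ 3) / f x := by
  rw [logDeriv_apply, (hasDerivAt_of_eq_quartic c₀ c₁ c₂ c₃ c₄ hf x).deriv]

theorem logDeriv_P₄ (x : ℂ) : logDeriv P₄ x = (-1 + 1 / 2 * x - 3 / 56 * x ^ 2) / P₄ x := by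
  rw [logDeriv_eq_of_eq_quartic 1 (-1) (1 / 4) (-1 / 56) 0 fun x => by rw [P₄]; ring]
  ring

theorem logDeriv_Q₄ (x : ℂ) :
    logDeriv Q₄ x = (-1 / 2 + 1 / 14 * x + 3 / 56 * x ^ 2 - 1 / 98 * x ^ 3) / Q₄ x := by
  rw [logDeriv_eq_of_eq_quartic 1 (-1 / 2) (1 / 28) (1 / 56) (-1 / 392) fun x => by rw [Q₄]; ring]
  ring

theorem logDeriv_R₁ (x : ℂ) : logDeriv R₁ x = (-3 / 8 + 1 / 14 * x) / R₁ x := by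
  rw [logDeriv_eq_of_eq_quartic 1 (-3 / 8) (1 / 28) 0 0 fun x => by rw [R₁]; ring]
  ring

theorem logDeriv_R₂ (x : ℂ) :
    logDeriv R₂ x = (-33 / 32 + 13 / 16 * x - 27 / 128 * x ^ 2 + 1 / 56 * x ^ 3) / R₂ x := by
  rw [logDeriv_eq_of_eq_quartic 1 (-33 / 32) (13 / 32) (-9 / 128) (1 / 224)
    fun x => by rw [R₂]; ring]
  ring

theorem Psi₄_eq (x : ℂ) : Psi₄ x = -343 / 32 * (x * R₁ x ^ 2 * Q₄ x ^ 4 / P₄ x ^ 7) := by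
  have hR : 2 * x ^ 2 - 21 * x + 56 = 56 * R₁ x := by
    rw [R₁]
    ring
  have hQ : (x ^ 2 - 28) ^ 4 * (x ^ 2 - 7 * x + 14) ^ 4 = 28 ^ 4 * 14 ^ 4 * Q₄ x ^ 4 := by
    rw [Q₄]
    ring
  have hP : x ^ 3 - 14 * x ^ 2 + 56 * x - 56 = -56 * P₄ x := by
    rw [P₄]
    ring
  rw [Psi₄, mul_assoc (x * _), hR, hQ, hP]
  simp only [mul_pow, div_eq_mul_inv, mul_inv]
  ring

theorem hasDerivAt_Psi₄_zero : HasDerivAt Psi₄ (-343 / 32) 0 := by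
  have hunit : DifferentiableAt ℂ (fun x => R₁ x ^ 2 * Q₄ x ^ 4 / P₄ x ^ 7) 0 := by
    refine DifferentiableAt.fun_div ?_ ?_ ?_ <;> first | fun_prop | simp
  have h := ((hasDerivAt_id' (0 : ℂ)).fun_mul hunit.hasDerivAt).const_mul (-343 / 32)
  simp only [P₄_zero, Q₄_zero, R₁_zero] at h
  refine (h.congr_deriv (by norm_num)).congr_of_eventuallyEq (.of_forall fun x => ?_)
  rw [Psi₄_eq]
  ring

theorem isSimpleZero_Psi₄ : IsSimpleZero Psi₄ 0 where
  analyticAt := by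
    rw [funext Psi₄_eq]
    exact analyticAt_const.fun_mul <| (Differentiable.analyticAt (by fun_prop) 0).fun_div
      (Differentiable.analyticAt (by fun_prop) 0) (by simp)
  eq_zero := by simp [Psi₄]
  deriv_ne_zero := by
    rw [hasDerivAt_Psi₄_zero.deriv]
    norm_num

/-- The polynomial whose roots are the ramification points of `Psi₄` other than those above `0` and
`∞`: it is the numerator of the logarithmic derivative of `Psi₄`. -/
def ramPoly (x : ℂ) : ℂ :=
  1 + 19 / 8 * x - 63 / 16 * x ^ 2 + 39 / 16 * x ^ 3 - 193 / 224 * x ^ 4 + 173 / 896 * x ^ 5 -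
    7 / 256 * x ^ 6 + 1 / 448 * x ^ 7 - 1 / 12544 * x ^ 8

/-- The points where every function occurring in the evaluations is nonzero and holomorphic. The
condition `x ≠ 5` is due to the denominators of `logDerivK₀` and `logDerivK₁`. -/
structure IsRegularPoint (x : ℂ) : Prop where
  ne_zero : x ≠ 0
  ne_five : x ≠ 5
  P₄_mem : P₄ x ∈ Complex.slitPlane
  Q₄_ne_zero : Q₄ x ≠ 0
  R₁_mem : R₁ x ∈ Complex.slitPlane
  R₁_mul_R₂_mem : R₁ x * R₂ x ∈ Complex.slitPlane
  ramPoly_ne_zero : ramPoly x ≠ 0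

theorem eventually_mem_slitPlane {f : ℂ → ℂ} {x₀ : ℂ} (hf : ContinuousAt f x₀) (h : f x₀ = 1) :
    ∀ᶠ x in 𝓝[≠] x₀, f x ∈ Complex.slitPlane :=
  (hf.eventually_mem (Complex.isOpen_slitPlane.mem_nhds (by simp [h]))).filter_mono
    nhdsWithin_le_nhds

theorem eventually_isRegularPoint : ∀ᶠ x in 𝓝[≠] 0, IsRegularPoint x := by
  have hram : ContinuousAt ramPoly 0 := by
    unfold ramPoly
    fun_prop
  filter_upwards [self_mem_nhdsWithin,
    (eventually_ne_nhds (show (0 : ℂ) ≠ 5 by norm_num)).filter_mono nhdsWithin_le_nhds,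
    eventually_mem_slitPlane differentiable_P₄.continuous.continuousAt P₄_zero,
    (differentiable_Q₄.continuous.continuousAt.eventually_ne (show Q₄ 0 ≠ 0 by simp)).filter_mono
      nhdsWithin_le_nhds,
    eventually_mem_slitPlane differentiable_R₁.continuous.continuousAt R₁_zero,
    eventually_mem_slitPlane (f := fun x => R₁ x * R₂ x)
      (differentiable_R₁.mul differentiable_R₂).continuous.continuousAt (by simp),
    (hram.eventually_ne (show ramPoly 0 ≠ 0 by simp [ramPoly])).filter_mono nhdsWithin_le_nhds]
  exact fun x h₀ h₅ hP hQ hR₁ hR hram => ⟨h₀, h₅, hP, hQ, hR₁, hR, hram⟩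

namespace IsRegularPoint

variable {x : ℂ}

theorem P₄_ne_zero (hx : IsRegularPoint x) : P₄ x ≠ 0 := Complex.slitPlane_ne_zero hx.P₄_mem

theorem R₁_ne_zero (hx : IsRegularPoint x) : R₁ x ≠ 0 := Complex.slitPlane_ne_zero hx.R₁_mem

theorem R₂_ne_zero (hx : IsRegularPoint x) : R₂ x ≠ 0 :=
  right_ne_zero_of_mul (Complex.slitPlane_ne_zero hx.R₁_mul_R₂_mem)

theorem hasLogDerivAt_id (hx : IsRegularPoint x) : HasLogDerivAt (fun x => x) (1 / x) x :=
  (hasDerivAt_id' x).congr_deriv (mul_one_div_cancel hx.ne_zero).symm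

theorem hasLogDerivAt_P₄ (hx : IsRegularPoint x) : HasLogDerivAt P₄ (logDeriv P₄ x) x :=
  hasLogDerivAt_of_differentiableAt (differentiable_P₄ x) hx.P₄_ne_zero

theorem hasLogDerivAt_Q₄ (hx : IsRegularPoint x) : HasLogDerivAt Q₄ (logDeriv Q₄ x) x :=
  hasLogDerivAt_of_differentiableAt (differentiable_Q₄ x) hx.Q₄_ne_zero

theorem hasLogDerivAt_R₁ (hx : IsRegularPoint x) : HasLogDerivAt R₁ (logDeriv R₁ x) x :=
  hasLogDerivAt_of_differentiableAt (differentiable_R₁ x) hx.R₁_ne_zero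

theorem hasLogDerivAt_R₂ (hx : IsRegularPoint x) : HasLogDerivAt R₂ (logDeriv R₂ x) x :=
  hasLogDerivAt_of_differentiableAt (differentiable_R₂ x) hx.R₂_ne_zero

theorem logDeriv_Psi₄ (hx : IsRegularPoint x) :
    logDeriv Psi₄ x = 1 / x + 2 * logDeriv R₁ x + 4 * logDeriv Q₄ x - 7 * logDeriv P₄ x := by
  have hP := hx.P₄_ne_zero
  have h := (((hx.hasLogDerivAt_id.mul (hx.hasLogDerivAt_R₁.pow 2)).mul
    (hx.hasLogDerivAt_Q₄.pow 4)).div (hx.hasLogDerivAt_P₄.pow 7) (pow_ne_zero 7 hP)).const_mul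
    (-343 / 32)
  rw [funext Psi₄_eq]
  exact_mod_cast h.logDeriv_eq (by simp [hP, hx.ne_zero, hx.R₁_ne_zero, hx.Q₄_ne_zero])

theorem logDeriv_Psi₄_eq_div (hx : IsRegularPoint x) :
    logDeriv Psi₄ x = ramPoly x / (x * R₁ x * Q₄ x * P₄ x) := by
  have := hx.ne_zero
  have := hx.P₄_ne_zero
  have := hx.Q₄_ne_zero
  have := hx.R₁_ne_zero
  rw [hx.logDeriv_Psi₄, logDeriv_R₁, logDeriv_Q₄, logDeriv_P₄]
  field_simp
  simp only [R₁, Q₄, P₄, ramPoly]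
  ring

theorem logDeriv_Psi₄_ne_zero (hx : IsRegularPoint x) : logDeriv Psi₄ x ≠ 0 := by
  simp [hx.logDeriv_Psi₄_eq_div, hx.ne_zero, hx.P₄_ne_zero, hx.Q₄_ne_zero, hx.R₁_ne_zero,
    hx.ramPoly_ne_zero]

end IsRegularPoint

end Covering

section RadicalEvaluations

theorem cpow_eq_cpow_mul_pow {y c d : ℂ} (hy : y ≠ 0) (n : ℕ) (h : d = c + n) :
    y ^ d = y ^ c * y ^ n := by
  rw [h, Complex.cpow_add _ _ hy, Complex.cpow_natCast]

theorem cpow_half_sq (y : ℂ) : (y ^ (1 / 2 : ℂ)) ^ 2 = y := by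
  rw [one_div]
  exact Complex.cpow_ofNat_inv_pow y 2

theorem cpow_ne_zero {y : ℂ} (hy : y ≠ 0) (c : ℂ) : y ^ c ≠ 0 := by
  simp [Complex.cpow_eq_zero_iff, hy]

theorem cpow_half_div_mul_cpow_half {p r : ℂ} (hp : p ≠ 0) (hr : r ≠ 0) (q : ℂ) :
    p ^ (1 / 2 : ℂ) / (q * r ^ (1 / 2 : ℂ)) =
      r ^ (1 / 2 : ℂ) / p ^ (3 / 2 : ℂ) * (p ^ 2 / (q * r)) := by
  have hp' := cpow_ne_zero hp (1 / 2)
  have hr' := cpow_ne_zero hr (1 / 2)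
  have hp₂ := cpow_half_sq p
  have hr₂ := cpow_half_sq r
  rw [cpow_eq_cpow_mul_pow (d := 3 / 2) (c := 1 / 2) hp 1 (by norm_num)]
  field_simp
  rw [hp₂, hr₂]
  ring

theorem cpow_nine_half_div_mul_cpow_three_half {p r : ℂ} (hp : p ≠ 0) (hr : r ≠ 0) (q : ℂ) :
    p ^ (9 / 2 : ℂ) / (q * r ^ (3 / 2 : ℂ)) =
      r ^ (1 / 2 : ℂ) / p ^ (3 / 2 : ℂ) * (p ^ 6 / (q * r ^ 2)) := by
  rw [cpow_eq_cpow_mul_pow (d := 9 / 2) (c := 1 / 2) hp 4 (by norm_num),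
    cpow_eq_cpow_mul_pow (d := 3 / 2) (c := 1 / 2) hr 1 (by norm_num)]
  linear_combination (norm := field_simp) p ^ 4 / r * cpow_half_div_mul_cpow_half hp hr q
  ring

theorem isContiguitySystemAt_radical {x : ℂ} (hx : IsRegularPoint x) :
    IsContiguitySystemAt Psi₄ ![-3 / 14, 1 / 14, 9 / 14] ![1 / 4, 3 / 4]
      (fun x => R₁ x ^ (1 / 2 : ℂ) / P₄ x ^ (3 / 2 : ℂ) *
        (1 - 3 / 4 * x + 1 / 4 * x ^ 2 - 3 / 112 * x ^ 3))
      (fun x => P₄ x ^ (1 / 2 : ℂ) / (Q₄ x * R₁ x ^ (1 / 2 : ℂ)) *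
        (1 - 3 / 5 * x + 1 / 8 * x ^ 2 - 1 / 112 * x ^ 3))
      (fun x => P₄ x ^ (9 / 2 : ℂ) / (Q₄ x ^ 3 * R₁ x ^ (3 / 2 : ℂ)) * (1 - 3 / 14 * x)) x := by
  have hP₀ := hx.P₄_ne_zero
  have hQ₀ := hx.Q₄_ne_zero
  have hR₀ := hx.R₁_ne_zero
  have hram := hx.ramPoly_ne_zero
  have hP := hx.hasLogDerivAt_P₄.cpow_const hx.P₄_mem
  have hR := hx.hasLogDerivAt_R₁.cpow_const hx.R₁_mem
  have hρ₀ := (hR (1 / 2)).div (hP (3 / 2)) (cpow_ne_zero hP₀ _)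
  have hρ₁ := (hP (1 / 2)).div (hx.hasLogDerivAt_Q₄.mul (hR (1 / 2)))
    (mul_ne_zero hQ₀ (cpow_ne_zero hR₀ _))
  have hρ₂ := (hP (9 / 2)).div ((hx.hasLogDerivAt_Q₄.pow 3).mul (hR (3 / 2)))
    (mul_ne_zero (pow_ne_zero 3 hQ₀) (cpow_ne_zero hR₀ _))
  have hn₀ := hasDerivAt_of_eq_quartic (f := fun x => 1 - 3 / 4 * x + 1 / 4 * x ^ 2 -
    3 / 112 * x ^ 3) 1 (-3 / 4) (1 / 4) (-3 / 112) 0 (fun x => by ring) x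
  have hn₁ := hasDerivAt_of_eq_quartic (f := fun x => 1 - 3 / 5 * x + 1 / 8 * x ^ 2 -
    1 / 112 * x ^ 3) 1 (-3 / 5) (1 / 8) (-1 / 112) 0 (fun x => by ring) x
  have hn₂ := hasDerivAt_of_eq_quartic (f := fun x => 1 - 3 / 14 * x)
    1 (-3 / 14) 0 0 0 (fun x => by ring) x
  refine ⟨?_, ?_, ?_⟩ <;> simp only [hρ₀.pullOp_mul hn₀, hρ₁.pullOp_mul hn₁, hρ₂.pullOp_mul hn₂,
    cpow_half_div_mul_cpow_half hP₀ hR₀, cpow_nine_half_div_mul_cpow_three_half hP₀ hR₀,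
    hx.logDeriv_Psi₄_eq_div, Psi₄_eq, logDeriv_P₄, logDeriv_Q₄, logDeriv_R₁,
    Matrix.cons_val_zero, Matrix.cons_val_one, Matrix.cons_val]
  all_goals
    generalize R₁ x ^ (1 / 2 : ℂ) / P₄ x ^ (3 / 2 : ℂ) = ρ
    field_simp
    simp only [R₁, P₄, Q₄, ramPoly]
    ring

theorem mem_integerComplement_of_mul_eq {c : ℂ} {p q : ℤ} (h : q * c = p) (hpq : ¬q ∣ p) :
    c ∈ Complex.integerComplement := by
  rintro ⟨n, rfl⟩
  exact hpq ⟨n, by exact_mod_cast h.symm⟩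

theorem analyticAt_cpow_const_of_eq_one {f : ℂ → ℂ} {x₀ : ℂ} (hf : AnalyticAt ℂ f x₀)
    (h : f x₀ = 1) (c : ℂ) : AnalyticAt ℂ (fun x => f x ^ c) x₀ :=
  hf.cpow analyticAt_const (by simp [h])

theorem analyticAt_P₄_cpow (c : ℂ) : AnalyticAt ℂ (fun x => P₄ x ^ c) 0 :=
  analyticAt_cpow_const_of_eq_one (differentiable_P₄.analyticAt 0) P₄_zero c

theorem analyticAt_R₁_cpow (c : ℂ) : AnalyticAt ℂ (fun x => R₁ x ^ c) 0 :=
  analyticAt_cpow_const_of_eq_one (differentiable_R₁.analyticAt 0) R₁_zero c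

theorem radical_evaluations :
    (∀ᶠ x in 𝓝 (0 : ℂ),
      hyp3F2 ![9 / 14, 11 / 14, 15 / 14] ![5 / 4, 7 / 4] (Psi₄ x) =
        P₄ x ^ (9 / 2 : ℂ) / (Q₄ x ^ 3 * R₁ x ^ (3 / 2 : ℂ)) * (1 - 3 / 14 * x)) ∧
    (∀ᶠ x in 𝓝 (0 : ℂ),
      hyp3F2 ![1 / 14, 9 / 14, 11 / 14] ![3 / 4, 5 / 4] (Psi₄ x) =
        P₄ x ^ (1 / 2 : ℂ) / (Q₄ x * R₁ x ^ (1 / 2 : ℂ)) *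
          (1 - 3 / 5 * x + 1 / 8 * x ^ 2 - 1 / 112 * x ^ 3)) ∧
    (∀ᶠ x in 𝓝 (0 : ℂ),
      hyp3F2 ![-3 / 14, 1 / 14, 9 / 14] ![1 / 4, 3 / 4] (Psi₄ x) =
        R₁ x ^ (1 / 2 : ℂ) / P₄ x ^ (3 / 2 : ℂ) *
          (1 - 3 / 4 * x + 1 / 4 * x ^ 2 - 3 / 112 * x ^ 3)) := by
  have hQ := differentiable_Q₄.analyticAt 0
  have hY₀ : AnalyticAt ℂ (fun x => R₁ x ^ (1 / 2 : ℂ) / P₄ x ^ (3 / 2 : ℂ) *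
      (1 - 3 / 4 * x + 1 / 4 * x ^ 2 - 3 / 112 * x ^ 3)) 0 :=
    ((analyticAt_R₁_cpow _).fun_div (analyticAt_P₄_cpow _) (by simp)).fun_mul (by fun_prop)
  have hY₁ : AnalyticAt ℂ (fun x => P₄ x ^ (1 / 2 : ℂ) / (Q₄ x * R₁ x ^ (1 / 2 : ℂ)) *
      (1 - 3 / 5 * x + 1 / 8 * x ^ 2 - 1 / 112 * x ^ 3)) 0 :=
    ((analyticAt_P₄_cpow _).fun_div (hQ.fun_mul (analyticAt_R₁_cpow _)) (by simp)).fun_mul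
      (by fun_prop)
  have hY₂ : AnalyticAt ℂ (fun x => P₄ x ^ (9 / 2 : ℂ) / (Q₄ x ^ 3 * R₁ x ^ (3 / 2 : ℂ)) *
      (1 - 3 / 14 * x)) 0 :=
    ((analyticAt_P₄_cpow _).fun_div ((hQ.fun_pow 3).fun_mul (analyticAt_R₁_cpow _))
      (by simp)).fun_mul (by fun_prop)
  obtain ⟨h₀, h₁, h₂⟩ := IsContiguitySystemAt.eventuallyEq_hyp3F2_comp isSimpleZero_Psi₄
    (fun i => mem_integerComplement_of_mul_eq (q := 14) (p := ![-3, 1, 9] i)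
      (by fin_cases i <;> norm_num) (by fin_cases i <;> decide))
    (fun j => mem_integerComplement_of_mul_eq (q := 4) (p := ![1, 3] j)
      (by fin_cases j <;> norm_num) (by fin_cases j <;> decide))
    hY₀.meromorphicAt hY₁.meromorphicAt hY₂.meromorphicAt
    (by simpa using hY₀.continuousAt.tendsto.mono_left nhdsWithin_le_nhds)
    (eventually_isRegularPoint.mono fun x hx => isContiguitySystemAt_radical hx)
  rw [hyp3F2_add_single_zero, show (-3 / 14 + 1 : ℂ) = 11 / 14 by norm_num,
    show (1 / 4 + 1 : ℂ) = 5 / 4 by norm_num] at h₁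
  rw [hyp3F2_add_single_zero_add_single_one, show (-3 / 14 + 1 : ℂ) = 11 / 14 by norm_num,
    show (1 / 14 + 1 : ℂ) = 15 / 14 by norm_num, show (1 / 4 + 1 : ℂ) = 5 / 4 by norm_num,
    show (3 / 4 + 1 : ℂ) = 7 / 4 by norm_num] at h₂
  have hΨ : Psi₄ 0 = 0 := isSimpleZero_Psi₄.eq_zero
  exact ⟨eventuallyEq_nhds_of_eventuallyEq_nhdsNE h₂.symm (by simp [hΨ, hyp3F2_zero]),
    eventuallyEq_nhds_of_eventuallyEq_nhdsNE h₁.symm (by simp [hΨ, hyp3F2_zero]),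
    eventuallyEq_nhds_of_eventuallyEq_nhdsNE h₀.symm (by simp [hΨ, hyp3F2_zero])⟩

end RadicalEvaluations

section DihedralSystem

/-- The base of the fourth root `K` in the dihedral evaluations, for a branch `w` of the square root
of `R₁ R₂`. -/
def dihedralBase (w : ℂ → ℂ) (x : ℂ) : ℂ :=
  1 / 2 * w x + 1 / 2 - 45 / 128 * x + 5 / 64 * x ^ 2 - 5 / 896 * x ^ 3

/-- The rational part of the logarithmic derivative `logDerivK₀ x + logDerivK₁ x * w x` of the
fourth root of `dihedralBase w`. -/
def logDerivK₀ (x : ℂ) : ℂ := (3 / 4 * x - 5 / 4) / (x * (x - 5))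

/-- The coefficient of the square root `w` of `R₁ R₂` in the logarithmic derivative
`logDerivK₀ x + logDerivK₁ x * w x` of the fourth root of `dihedralBase w`. -/
def logDerivK₁ (x : ℂ) : ℂ :=
  (5 / 4 - 3 / 4 * x + 5 / 32 * x ^ 2 - 5 / 448 * x ^ 3) / (x * (x - 5) * R₁ x * R₂ x)

/-- At the regular point `x`, the function `w` is a branch of the square root of `R₁ R₂`. -/
structure IsSqrtBranchAt (w : ℂ → ℂ) (x : ℂ) : Prop where
  isRegularPoint : IsRegularPoint x
  sq_eq : w x ^ 2 = R₁ x * R₂ x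
  hasLogDerivAt_sqrt : HasLogDerivAt w (1 / 2 * (logDeriv R₁ x + logDeriv R₂ x)) x

/-- At the regular point `x`, the function `w` is a branch of the square root of `R₁ R₂`, and `ρ` is
a prefactor with the logarithmic derivative of `Psi₄ ^ σ / (P₄ ^ (3 / 4) K)`, where `K` is the
fourth root of `dihedralBase w`. -/
structure IsDihedralPrefactorAt (σ : ℂ) (ρ w : ℂ → ℂ) (x : ℂ) : Prop extends
    IsSqrtBranchAt w x where
  hasLogDerivAt : HasLogDerivAt ρ (-3 / 4 * logDeriv P₄ x - (logDerivK₀ x + logDerivK₁ x * w x) +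
    σ * logDeriv Psi₄ x) x

/-- The first of the three contiguous functions of the dihedral evaluations, for a prefactor `ρ` and
a branch `w` of the square root of `R₁ R₂`. The factor `1` gives all three functions the shape
`ρ * g * (A + B * w)` with `A`, `B` polynomials and `g` a product of powers of `P₄`, `Q₄`, `R₁`. -/
def dihedral₀ (ρ w : ℂ → ℂ) (x : ℂ) : ℂ :=
  ρ x * 1 * (1 / 2 - 15 / 32 * x + 53 / 448 * x ^ 2 - 1 / 112 * x ^ 3 + 1 / 2 * w x)

/-- The second of the three contiguous functions of the dihedral evaluations. -/
def dihedral₁ (ρ w : ℂ → ℂ) (x : ℂ) : ℂ :=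
  ρ x * (P₄ x / (Q₄ x * R₁ x)) *
    ((1 / 2 - 11 / 48 * x + 17 / 1344 * x ^ 3 - 1 / 672 * x ^ 4) * R₁ x +
      (1 / 2 - 5 / 24 * x + 1 / 48 * x ^ 2) * w x)

/-- The third of the three contiguous functions of the dihedral evaluations. -/
def dihedral₂ (ρ w : ℂ → ℂ) (x : ℂ) : ℂ :=
  ρ x * (P₄ x ^ 3 / (Q₄ x ^ 2 * R₁ x)) *
    (1 - 3 / 5 * x + 1 / 8 * x ^ 2 - 1 / 112 * x ^ 3 + -2 / 5 * x * w x)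

theorem hasDerivAt_dihedralBase {w : ℂ → ℂ} {w' x : ℂ} (hw : HasDerivAt w w' x) :
    HasDerivAt (dihedralBase w) (1 / 2 * w' - 45 / 128 + 5 / 32 * x - 15 / 896 * x ^ 2) x := by
  have h := (HasDerivAt.const_mul (1 / 2) hw).fun_add (hasDerivAt_of_eq_quartic
    (1 / 2) (-45 / 128) (5 / 64) (-5 / 896) 0 (fun _ => rfl) x)
  refine (h.congr_deriv ?_).congr_of_eventuallyEq (.of_forall fun x => ?_)
  · ring
  · rw [dihedralBase]
    ring

namespace IsSqrtBranchAt

variable {w : ℂ → ℂ} {x : ℂ}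

theorem neg (h : IsSqrtBranchAt w x) : IsSqrtBranchAt (-w) x where
  isRegularPoint := h.isRegularPoint
  sq_eq := by rw [Pi.neg_apply, neg_sq, h.sq_eq]
  hasLogDerivAt_sqrt := (HasDerivAt.neg h.hasLogDerivAt_sqrt).congr_deriv (neg_mul _ _).symm

theorem dihedralBase_mul_dihedralBase_neg (h : IsSqrtBranchAt w x) :
    dihedralBase w x * dihedralBase (-w) x = -625 / 114688 * x ^ 2 * (1 - 1 / 5 * x) ^ 4 := by
  have hw := h.sq_eq
  simp only [R₁, R₂] at hw
  simp only [dihedralBase, Pi.neg_apply]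
  linear_combination -1 / 4 * hw

theorem dihedralBase_ne_zero (h : IsSqrtBranchAt w x) : dihedralBase w x ≠ 0 := by
  refine left_ne_zero_of_mul (b := dihedralBase (-w) x) ?_
  have h₅ : 1 - 1 / 5 * x ≠ 0 := fun h₀ => h.isRegularPoint.ne_five (by linear_combination -5 * h₀)
  rw [h.dihedralBase_mul_dihedralBase_neg]
  exact mul_ne_zero (mul_ne_zero (by norm_num) (pow_ne_zero 2 h.isRegularPoint.ne_zero))
    (pow_ne_zero 4 h₅)

/-- Both branches have logarithmic derivatives of this shape because their norm is a constant times
`x² (x - 5)⁴`. -/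
theorem hasLogDerivAt_dihedralBase (h : IsSqrtBranchAt w x) :
    HasLogDerivAt (dihedralBase w) (4 * (logDerivK₀ x + logDerivK₁ x * w x)) x := by
  have hx₀ := h.isRegularPoint.ne_zero
  have hx₅ := sub_ne_zero.2 h.isRegularPoint.ne_five
  have hR₁ := h.isRegularPoint.R₁_ne_zero
  have hR₂ := h.isRegularPoint.R₂_ne_zero
  refine (hasDerivAt_dihedralBase h.hasLogDerivAt_sqrt).congr_deriv ?_
  have hw := h.sq_eq
  rw [logDeriv_R₁, logDeriv_R₂, logDerivK₀, logDerivK₁, dihedralBase]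
  linear_combination (norm := skip) -2 * (5 / 4 - 3 / 4 * x + 5 / 32 * x ^ 2 - 5 / 448 * x ^ 3) /
    (x * (x - 5) * R₁ x * R₂ x) * hw
  field_simp
  simp only [R₁, R₂]
  ring

end IsSqrtBranchAt

theorem mul_add_mul_eq_of_eq {R : Type*} [CommRing R] {k l g h A B C D : R}
    (hA : k * (g * A) = l * (h * C)) (hB : k * (g * B) = l * (h * D)) (ρ w : R) :
    k * (ρ * g * (A + B * w)) = l * (ρ * h * (C + D * w)) := by
  linear_combination ρ * hA + ρ * w * hB

namespace IsDihedralPrefactorAt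

variable {σ : ℂ} {ρ w : ℂ → ℂ} {x : ℂ}

theorem pullOp_mul_eq (h : IsDihedralPrefactorAt σ ρ w x) {g A B : ℂ → ℂ} {γ A' B' : ℂ}
    (hg : HasLogDerivAt g γ x) (hA : HasDerivAt A A' x) (hB : HasDerivAt B B' x) (c : ℂ) :
    pullOp Psi₄ (c - σ) (fun x => ρ x * g x * (A x + B x * w x)) x = ρ x * g x *
      ((A' + (γ - 3 / 4 * logDeriv P₄ x - logDerivK₀ x) * A x -
          logDerivK₁ x * (R₁ x * R₂ x) * B x) / logDeriv Psi₄ x + c * A x +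
        ((B' + (γ - 3 / 4 * logDeriv P₄ x - logDerivK₀ x +
            1 / 2 * (logDeriv R₁ x + logDeriv R₂ x)) * B x -
          logDerivK₁ x * A x) / logDeriv Psi₄ x + c * B x) * w x) := by
  have hρg : HasLogDerivAt (fun x => ρ x * g x)
      (γ - 3 / 4 * logDeriv P₄ x - logDerivK₀ x + -logDerivK₁ x * w x + σ * logDeriv Psi₄ x) x :=
    (h.hasLogDerivAt.mul hg).congr_logDeriv (by ring)
  rw [hρg.pullOp_mul_add_mul hA hB h.hasLogDerivAt_sqrt h.isRegularPoint.logDeriv_Psi₄_ne_zero,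
    h.sq_eq]
  ring

theorem pullOp_dihedral (h : IsDihedralPrefactorAt σ ρ w x) :
    -3 / 28 * pullOp Psi₄ (1 / 4 - σ) (dihedral₁ ρ w) x =
        1 / 4 * pullOp Psi₄ (-3 / 28 - σ) (dihedral₀ ρ w) x ∧
      1 / 28 * pullOp Psi₄ (1 / 2 - σ) (dihedral₂ ρ w) x =
        1 / 2 * pullOp Psi₄ (1 / 28 - σ) (dihedral₁ ρ w) x ∧
      1 / 8 * pullOp Psi₄ (0 - σ) (dihedral₀ ρ w) x =
        -3 / 784 * Psi₄ x * pullOp Psi₄ (9 / 28 - σ) (dihedral₂ ρ w) x := by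
  have hx := h.isRegularPoint
  have hx₀ := hx.ne_zero
  have hx₅ := sub_ne_zero.2 hx.ne_five
  have hP₀ := hx.P₄_ne_zero
  have hQ₀ := hx.Q₄_ne_zero
  have hR₁ := hx.R₁_ne_zero
  have hR₂ := hx.R₂_ne_zero
  have hram := hx.ramPoly_ne_zero
  have h₀ := h.pullOp_mul_eq (g := fun _ => 1) (γ := 0)
    (A := fun x => 1 / 2 - 15 / 32 * x + 53 / 448 * x ^ 2 - 1 / 112 * x ^ 3)
    ((hasDerivAt_const x 1).congr_deriv (one_mul 0).symm)
    (hasDerivAt_of_eq_quartic (1 / 2) (-15 / 32) (53 / 448) (-1 / 112) 0 (fun x => by ring) x)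
    (hasDerivAt_const x (1 / 2))
  have h₁ := h.pullOp_mul_eq
    (A := fun x => (1 / 2 - 11 / 48 * x + 17 / 1344 * x ^ 3 - 1 / 672 * x ^ 4) * R₁ x)
    (B := fun x => 1 / 2 - 5 / 24 * x + 1 / 48 * x ^ 2)
    (hx.hasLogDerivAt_P₄.div (hx.hasLogDerivAt_Q₄.mul hx.hasLogDerivAt_R₁) (mul_ne_zero hQ₀ hR₁))
    ((hasDerivAt_of_eq_quartic (1 / 2) (-11 / 48) 0 (17 / 1344) (-1 / 672)
      (fun x => by ring) x).fun_mul
      (hasDerivAt_of_eq_quartic 1 (-3 / 8) (1 / 28) 0 0 (fun x => by rw [R₁]; ring) x))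
    (hasDerivAt_of_eq_quartic (1 / 2) (-5 / 24) (1 / 48) 0 0 (fun x => by ring) x)
  have h₂ := h.pullOp_mul_eq
    (A := fun x => 1 - 3 / 5 * x + 1 / 8 * x ^ 2 - 1 / 112 * x ^ 3) (B := fun x => -2 / 5 * x)
    ((hx.hasLogDerivAt_P₄.pow 3).div ((hx.hasLogDerivAt_Q₄.pow 2).mul hx.hasLogDerivAt_R₁)
      (mul_ne_zero (pow_ne_zero 2 hQ₀) hR₁))
    (hasDerivAt_of_eq_quartic 1 (-3 / 5) (1 / 8) (-1 / 112) 0 (fun x => by ring) x)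
    (hasDerivAt_of_eq_quartic 0 (-2 / 5) 0 0 0 (fun x => by ring) x)
  unfold dihedral₀ dihedral₁ dihedral₂
  refine ⟨?_, ?_, ?_⟩ <;> simp only [h₀, h₁, h₂] <;>
    refine mul_add_mul_eq_of_eq ?_ ?_ _ _
  all_goals
    simp only [hx.logDeriv_Psi₄_eq_div, Psi₄_eq, logDerivK₀, logDerivK₁, logDeriv_P₄,
      logDeriv_Q₄, logDeriv_R₁, logDeriv_R₂]
    field_simp
    simp only [R₁, R₂, P₄, Q₄, ramPoly]
    ring

theorem isContiguitySystemAt (h : IsDihedralPrefactorAt 0 ρ w x) :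
    IsContiguitySystemAt Psi₄ ![-3 / 28, 1 / 28, 9 / 28] ![1 / 4, 1 / 2]
      (dihedral₀ ρ w) (dihedral₁ ρ w) (dihedral₂ ρ w) x := by
  obtain ⟨h₁, h₂, h₀⟩ := h.pullOp_dihedral
  simp only [sub_zero] at h₀ h₁ h₂
  refine ⟨?_, h₁, h₂⟩
  linear_combination (norm := simp) h₀
  ring

theorem differentiableAt_dihedral₂ (h : IsDihedralPrefactorAt σ ρ w x) :
    DifferentiableAt ℂ (dihedral₂ ρ w) x := by
  have hρ := HasDerivAt.differentiableAt h.hasLogDerivAt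
  have hw := HasDerivAt.differentiableAt h.hasLogDerivAt_sqrt
  have hQR : Q₄ x ^ 2 * R₁ x ≠ 0 :=
    mul_ne_zero (pow_ne_zero 2 h.isRegularPoint.Q₄_ne_zero) h.isRegularPoint.R₁_ne_zero
  unfold dihedral₂
  fun_prop (disch := exact hQR)

/-- Multiplication by `Psi₄` lowers the parameter `9 / 28 + 1 / 2` to `-5 / 28`, which turns the
three relations into a contiguity system starting from `dihedral₂`. -/
theorem isContiguitySystemAt_companion (h : IsDihedralPrefactorAt (-1 / 2) ρ w x) :
    IsContiguitySystemAt Psi₄ ![-5 / 28, 11 / 28, 15 / 28] ![1 / 2, 3 / 4]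
      (fun x => -32 / 343 * (Psi₄ x * dihedral₂ ρ w x)) (fun x => -128 / 15 * dihedral₀ ρ w x)
      (fun x => 384 / 55 * dihedral₁ ρ w x) x := by
  obtain ⟨h₁, h₂, h₀⟩ := h.pullOp_dihedral
  have hΨ := h.isRegularPoint.logDeriv_Psi₄_ne_zero
  have hd := h.differentiableAt_dihedral₂
  refine ⟨?_, ?_, ?_⟩ <;> simp only [pullOp_const_mul, pullOp_self_mul hΨ hd, Matrix.cons_val_zero,
    Matrix.cons_val_one, Matrix.cons_val]
  all_goals norm_num at h₀ h₁ h₂ ⊢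
  · linear_combination 48 / 49 * Psi₄ x * h₂
  · linear_combination 256 / 21 * h₀
  · linear_combination -128 / 5 * h₁

end IsDihedralPrefactorAt

end DihedralSystem

section DihedralEvaluations

theorem analyticAt_sqrtR : AnalyticAt ℂ sqrtR 0 :=
  analyticAt_cpow_const_of_eq_one (f := fun x => R₁ x * R₂ x)
    ((differentiable_R₁.mul differentiable_R₂).analyticAt 0) (by simp) _

@[simp] theorem sqrtR_zero : sqrtR 0 = 1 := by simp [sqrtR]

theorem analyticAt_dihedralBase_sqrtR : AnalyticAt ℂ (dihedralBase sqrtR) 0 := by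
  have := analyticAt_sqrtR
  unfold dihedralBase
  fun_prop

@[simp] theorem dihedralBase_sqrtR_zero : dihedralBase sqrtR 0 = 1 := by
  rw [dihedralBase, sqrtR_zero]
  norm_num

theorem IsRegularPoint.isSqrtBranchAt_sqrtR {x : ℂ} (hx : IsRegularPoint x) :
    IsSqrtBranchAt sqrtR x where
  isRegularPoint := hx
  sq_eq := cpow_half_sq _
  hasLogDerivAt_sqrt := (hx.hasLogDerivAt_R₁.mul hx.hasLogDerivAt_R₂).cpow_const hx.R₁_mul_R₂_mem _

/-- The prefactor of the first dihedral evaluation. -/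
def dihedralPrefactor (x : ℂ) : ℂ := (P₄ x ^ (3 / 4 : ℂ) * K₁ x)⁻¹

/-- The prefactor of the second dihedral evaluation, to be used with the branch `-sqrtR`: it
corresponds to `Psi₄ ^ (-1 / 2) / (P₄ ^ (3 / 4) K)`. -/
def companionPrefactor (x : ℂ) : ℂ :=
  P₄ x ^ (11 / 4 : ℂ) / (Q₄ x ^ 2 * R₁ x) / (x * K₂ x)

theorem IsRegularPoint.isDihedralPrefactorAt_dihedralPrefactor {x : ℂ} (hx : IsRegularPoint x)
    (hK : dihedralBase sqrtR x ∈ Complex.slitPlane) :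
    IsDihedralPrefactorAt 0 dihedralPrefactor sqrtR x where
  toIsSqrtBranchAt := hx.isSqrtBranchAt_sqrtR
  hasLogDerivAt :=
    (((hx.hasLogDerivAt_P₄.cpow_const hx.P₄_mem (3 / 4)).mul
      (hx.isSqrtBranchAt_sqrtR.hasLogDerivAt_dihedralBase.cpow_const hK (1 / 4))).inv
      (mul_ne_zero (cpow_ne_zero hx.P₄_ne_zero _)
        (cpow_ne_zero (Complex.slitPlane_ne_zero hK) _))).congr_logDeriv (by ring)

theorem K₂_eq (x : ℂ) :
    K₂ x = (-2 * dihedralBase (-sqrtR) x / (625 / 57344 * x ^ 2)) ^ (1 / 4 : ℂ) := by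
  rw [K₂, dihedralBase, Pi.neg_apply]
  ring_nf

/-- The extension of the base of `K₂` across its removable singularity `0`, obtained by multiplying
numerator and denominator with the conjugate `dihedralBase sqrtR`. -/
def companionBase (x : ℂ) : ℂ := (1 - 1 / 5 * x) ^ 4 / dihedralBase sqrtR x

theorem IsRegularPoint.dihedralBase_neg_sqrtR_div {x : ℂ} (hx : IsRegularPoint x) :
    -2 * dihedralBase (-sqrtR) x / (625 / 57344 * x ^ 2) =
      companionBase x := by
  have hx₀ := hx.ne_zero
  have h := hx.isSqrtBranchAt_sqrtR
  rw [companionBase, div_eq_div_iff (by simp [hx₀]) h.dihedralBase_ne_zero]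
  linear_combination -2 * h.dihedralBase_mul_dihedralBase_neg

theorem IsRegularPoint.hasLogDerivAt_K₂ {x : ℂ} (hx : IsRegularPoint x)
    (hK : -2 * dihedralBase (-sqrtR) x / (625 / 57344 * x ^ 2) ∈ Complex.slitPlane) :
    HasLogDerivAt K₂ (logDerivK₀ x - logDerivK₁ x * sqrtR x - 1 / 2 * (1 / x)) x := by
  rw [funext K₂_eq]
  refine (((hx.isSqrtBranchAt_sqrtR.neg.hasLogDerivAt_dihedralBase.const_mul (-2)).div
    ((hx.hasLogDerivAt_id.pow 2).const_mul (625 / 57344)) (by simp [hx.ne_zero])).cpow_const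
    hK (1 / 4)).congr_logDeriv ?_
  rw [Pi.neg_apply]
  push_cast
  ring

theorem IsRegularPoint.isDihedralPrefactorAt_companionPrefactor {x : ℂ} (hx : IsRegularPoint x)
    (hK : -2 * dihedralBase (-sqrtR) x / (625 / 57344 * x ^ 2) ∈ Complex.slitPlane) :
    IsDihedralPrefactorAt (-1 / 2) companionPrefactor (-sqrtR) x where
  toIsSqrtBranchAt := hx.isSqrtBranchAt_sqrtR.neg
  hasLogDerivAt := by
    have hK₂ : K₂ x ≠ 0 := by
      rw [K₂_eq]
      exact cpow_ne_zero (Complex.slitPlane_ne_zero hK) _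
    refine (((hx.hasLogDerivAt_P₄.cpow_const hx.P₄_mem (11 / 4)).div
      ((hx.hasLogDerivAt_Q₄.pow 2).mul hx.hasLogDerivAt_R₁)
      (mul_ne_zero (pow_ne_zero 2 hx.Q₄_ne_zero) hx.R₁_ne_zero)).div
      (hx.hasLogDerivAt_id.mul (hx.hasLogDerivAt_K₂ hK))
      (mul_ne_zero hx.ne_zero hK₂)).congr_logDeriv ?_
    rw [hx.logDeriv_Psi₄, Pi.neg_apply]
    push_cast
    ring

theorem analyticAt_companionBase : AnalyticAt ℂ companionBase 0 :=
  AnalyticAt.fun_div (by fun_prop) analyticAt_dihedralBase_sqrtR (by simp)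

@[simp] theorem companionBase_zero : companionBase 0 = 1 := by simp [companionBase]

theorem analyticAt_companionBase_cpow (c : ℂ) : AnalyticAt ℂ (fun x => companionBase x ^ c) 0 :=
  analyticAt_cpow_const_of_eq_one analyticAt_companionBase companionBase_zero c

theorem K₂_eventuallyEq : K₂ =ᶠ[𝓝[≠] 0] fun x => companionBase x ^ (1 / 4 : ℂ) := by
  filter_upwards [eventually_isRegularPoint] with x hx
  rw [K₂_eq, hx.dihedralBase_neg_sqrtR_div]

section

variable {ρ w : ℂ → ℂ} {x₀ : ℂ}

@[fun_prop]
theorem meromorphicAt_dihedral₀ (hρ : MeromorphicAt ρ x₀) (hw : MeromorphicAt w x₀) :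
    MeromorphicAt (dihedral₀ ρ w) x₀ := by
  unfold dihedral₀
  fun_prop

@[fun_prop]
theorem meromorphicAt_dihedral₁ (hρ : MeromorphicAt ρ x₀) (hw : MeromorphicAt w x₀) :
    MeromorphicAt (dihedral₁ ρ w) x₀ := by
  unfold dihedral₁ P₄ Q₄ R₁
  fun_prop

@[fun_prop]
theorem meromorphicAt_dihedral₂ (hρ : MeromorphicAt ρ x₀) (hw : MeromorphicAt w x₀) :
    MeromorphicAt (dihedral₂ ρ w) x₀ := by
  unfold dihedral₂ P₄ Q₄ R₁
  fun_prop

end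

theorem analyticAt_dihedralPrefactor : AnalyticAt ℂ dihedralPrefactor 0 :=
  ((analyticAt_P₄_cpow _).fun_mul (analyticAt_cpow_const_of_eq_one analyticAt_dihedralBase_sqrtR
    dihedralBase_sqrtR_zero _)).fun_inv (by simp)

theorem dihedralPrefactor_zero : dihedralPrefactor 0 = 1 := by
  have hK : K₁ 0 = dihedralBase sqrtR 0 ^ (1 / 4 : ℂ) := rfl
  simp [dihedralPrefactor, hK]

theorem analyticAt_dihedral₀ : AnalyticAt ℂ (dihedral₀ dihedralPrefactor sqrtR) 0 := by
  have hρ := analyticAt_dihedralPrefactor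
  have hw := analyticAt_sqrtR
  unfold dihedral₀
  fun_prop

theorem dihedral₀_zero : dihedral₀ dihedralPrefactor sqrtR 0 = 1 := by
  rw [dihedral₀, dihedralPrefactor_zero, sqrtR_zero]
  norm_num

theorem dihedral_evaluation : ∀ᶠ x in 𝓝 (0 : ℂ),
    hyp3F2 ![-3 / 28, 1 / 28, 9 / 28] ![1 / 4, 1 / 2] (Psi₄ x) =
      (1 / 2 * sqrtR x + 1 / 2 - 15 / 32 * x + 53 / 448 * x ^ 2 - 1 / 112 * x ^ 3) /
        (P₄ x ^ (3 / 4 : ℂ) * K₁ x) := by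
  have hρ := analyticAt_dihedralPrefactor.meromorphicAt
  have hw := analyticAt_sqrtR.meromorphicAt
  have hsys : ∀ᶠ x in 𝓝[≠] 0, IsContiguitySystemAt Psi₄ ![-3 / 28, 1 / 28, 9 / 28]
      ![1 / 4, 1 / 2] (dihedral₀ dihedralPrefactor sqrtR) (dihedral₁ dihedralPrefactor sqrtR)
      (dihedral₂ dihedralPrefactor sqrtR) x := by
    filter_upwards [eventually_isRegularPoint, eventually_mem_slitPlane
      analyticAt_dihedralBase_sqrtR.continuousAt dihedralBase_sqrtR_zero] with x hx hK
    exact (hx.isDihedralPrefactorAt_dihedralPrefactor hK).isContiguitySystemAt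
  have h := (IsContiguitySystemAt.eventuallyEq_hyp3F2_comp isSimpleZero_Psi₄
    (fun i => mem_integerComplement_of_mul_eq (q := 28) (p := ![-3, 1, 9] i)
      (by fin_cases i <;> norm_num) (by fin_cases i <;> decide))
    (fun j => mem_integerComplement_of_mul_eq (q := 4) (p := ![1, 2] j)
      (by fin_cases j <;> norm_num) (by fin_cases j <;> decide))
    (by fun_prop) (by fun_prop) (by fun_prop)
    (dihedral₀_zero ▸ analyticAt_dihedral₀.continuousAt.tendsto.mono_left nhdsWithin_le_nhds)
    hsys).1
  have h₀ : dihedral₀ dihedralPrefactor sqrtR 0 =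
      (hyp3F2 ![-3 / 28, 1 / 28, 9 / 28] ![1 / 4, 1 / 2] ∘ Psi₄) 0 := by
    simp [dihedral₀_zero, isSimpleZero_Psi₄.eq_zero, hyp3F2_zero]
  filter_upwards [eventuallyEq_nhds_of_eventuallyEq_nhdsNE h h₀] with x hx
  rw [Function.comp_apply, dihedral₀, dihedralPrefactor] at hx
  rw [← hx]
  ring

theorem meromorphicAt_companionPrefactor : MeromorphicAt companionPrefactor 0 := by
  have hP := (analyticAt_P₄_cpow (11 / 4)).meromorphicAt
  have hK := (analyticAt_companionBase_cpow (1 / 4)).meromorphicAt.congr K₂_eventuallyEq.symm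
  unfold companionPrefactor Q₄ R₁
  fun_prop

theorem tendsto_Psi₄_mul_dihedral₂ :
    Tendsto (fun x => -32 / 343 * (Psi₄ x * dihedral₂ companionPrefactor (-sqrtR) x))
      (𝓝[≠] 0) (𝓝 1) := by
  have hP := differentiable_P₄.analyticAt 0
  have hw := analyticAt_sqrtR
  have h : AnalyticAt ℂ (fun x => P₄ x ^ (11 / 4 : ℂ) /
      (P₄ x ^ 4 * companionBase x ^ (1 / 4 : ℂ)) *
      (1 - 3 / 5 * x + 1 / 8 * x ^ 2 - 1 / 112 * x ^ 3 + 2 / 5 * x * sqrtR x)) 0 :=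
    ((analyticAt_P₄_cpow _).fun_div ((hP.fun_pow 4).fun_mul (analyticAt_companionBase_cpow _))
      (by simp)).fun_mul (by fun_prop)
  refine (h.continuousAt.tendsto.mono_left nhdsWithin_le_nhds).congr' ?_ |>.trans_eq (by simp)
  filter_upwards [eventually_isRegularPoint, K₂_eventuallyEq] with x hx hK
  have := hx.ne_zero
  have := hx.P₄_ne_zero
  have := hx.Q₄_ne_zero
  have := hx.R₁_ne_zero
  rw [← hK, Psi₄_eq, dihedral₂, companionPrefactor, Pi.neg_apply]
  field_simp

theorem dihedral_evaluation_companion : ∀ᶠ x in 𝓝[≠] (0 : ℂ),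
    hyp3F2 ![11 / 28, 15 / 28, 23 / 28] ![3 / 4, 3 / 2] (Psi₄ x) =
      P₄ x ^ (11 / 4 : ℂ) / (Q₄ x ^ 2 * R₁ x) *
        ((sqrtR x - 1 + 15 / 16 * x - 53 / 224 * x ^ 2 + 1 / 56 * x ^ 3) /
          (15 / 64 * x * K₂ x)) := by
  have hρ := meromorphicAt_companionPrefactor
  have hw := analyticAt_sqrtR.meromorphicAt.neg
  have hΨ := isSimpleZero_Psi₄.analyticAt.meromorphicAt
  have hsys : ∀ᶠ x in 𝓝[≠] 0, IsContiguitySystemAt Psi₄ ![-5 / 28, 11 / 28, 15 / 28]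
      ![1 / 2, 3 / 4] (fun x => -32 / 343 * (Psi₄ x * dihedral₂ companionPrefactor (-sqrtR) x))
      (fun x => -128 / 15 * dihedral₀ companionPrefactor (-sqrtR) x)
      (fun x => 384 / 55 * dihedral₁ companionPrefactor (-sqrtR) x) x := by
    filter_upwards [eventually_isRegularPoint, eventually_mem_slitPlane
      analyticAt_companionBase.continuousAt companionBase_zero] with x hx hK
    rw [← hx.dihedralBase_neg_sqrtR_div] at hK
    exact (hx.isDihedralPrefactorAt_companionPrefactor hK).isContiguitySystemAt_companion
  have h := (IsContiguitySystemAt.eventuallyEq_hyp3F2_comp isSimpleZero_Psi₄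
    (fun i => mem_integerComplement_of_mul_eq (q := 28) (p := ![-5, 11, 15] i)
      (by fin_cases i <;> norm_num) (by fin_cases i <;> decide))
    (fun j => mem_integerComplement_of_mul_eq (q := 4) (p := ![2, 3] j)
      (by fin_cases j <;> norm_num) (by fin_cases j <;> decide))
    (by fun_prop) (by fun_prop) (by fun_prop) tendsto_Psi₄_mul_dihedral₂ hsys).2.1
  rw [hyp3F2_add_single_zero, show (-5 / 28 + 1 : ℂ) = 23 / 28 by norm_num,
    show (1 / 2 + 1 : ℂ) = 3 / 2 by norm_num] at h
  filter_upwards [h, eventually_isRegularPoint] with x hx hreg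
  rw [Function.comp_apply, dihedral₀, companionPrefactor, Pi.neg_apply] at hx
  rw [← hx]
  field_simp
  ring

end DihedralEvaluations

section Companions

theorem isHypSolutionOn_companions :
    IsHypSolutionOn ![-3 / 28, 1 / 28, 9 / 28] ![1 / 4, 1 / 2] slitDisc
        (hyp3F2 ![-3 / 28, 1 / 28, 9 / 28] ![1 / 4, 1 / 2]) ∧
      IsHypSolutionOn ![-3 / 28, 1 / 28, 9 / 28] ![1 / 4, 1 / 2] slitDisc
        (fun z => z ^ (1 / 2 : ℂ) * hyp3F2 ![11 / 28, 15 / 28, 23 / 28] ![3 / 4, 3 / 2] z) ∧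
      IsHypSolutionOn ![-3 / 28, 1 / 28, 9 / 28] ![1 / 4, 1 / 2] slitDisc
        (fun z => z ^ (3 / 4 : ℂ) * hyp3F2 ![9 / 14, 11 / 14, 15 / 14] ![5 / 4, 7 / 4] z) := by
  have hb' {b' : Fin 2 → ℂ} (p : Fin 2 → ℤ) (h : ∀ j, 4 * b' j = p j) (hp : ∀ j, ¬4 ∣ p j)
      (j : Fin 2) (n : ℕ) : b' j + n ≠ 0 := by
    exact_mod_cast Complex.integerComplement_add_ne_zero
      (mem_integerComplement_of_mul_eq (q := 4) (by exact_mod_cast h j) (hp j)) n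
  refine ⟨?_, isHypSolutionOn_cpow_mul_hyp3F2 ?_ (hb' ![3, 6] ?_ (by decide)) ?_,
    isHypSolutionOn_cpow_mul_hyp3F2 ?_ (hb' ![5, 7] ?_ (by decide)) ?_⟩
  · have h := isHypSolutionOn_cpow_mul_hyp3F2 (a := ![-3 / 28, 1 / 28, 9 / 28])
      (b := ![1 / 4, 1 / 2]) (b' := ![1 / 4, 1 / 2]) (s := 0) (fun i => (add_zero _).symm)
      (hb' ![1, 2] (by norm_num [Fin.forall_fin_two]) (by decide)) (by simp)
    simpa only [Complex.cpow_zero, one_mul] using h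
  all_goals norm_num [Fin.forall_fin_succ]
  all_goals
    intro t
    ring

theorem contiguous_radical :
    Contiguous ![-3 / 14, 1 / 14, 9 / 14] ![1 / 4, 3 / 4]
        ![9 / 14, 11 / 14, 15 / 14] ![5 / 4, 7 / 4] ∧
      Contiguous ![-3 / 14, 1 / 14, 9 / 14] ![1 / 4, 3 / 4]
        ![1 / 14, 9 / 14, 11 / 14] ![3 / 4, 5 / 4] := by
  refine ⟨⟨⟨finRotate 3, fun i => ⟨![1, 1, 0] i, ?_⟩⟩, ⟨1, fun j => ⟨1, ?_⟩⟩⟩,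
    ⟨⟨(finRotate 3).symm, fun i => ⟨![1, 0, 0] i, ?_⟩⟩,
      ⟨Equiv.swap 0 1, fun j => ⟨![1, 0] j, ?_⟩⟩⟩⟩
  · fin_cases i <;> norm_num [finRotate_apply, Fin.add_def]
  · fin_cases j <;> norm_num
  · obtain ⟨k, rfl⟩ := (finRotate 3).surjective i
    rw [Equiv.symm_apply_apply]
    fin_cases k <;> norm_num [finRotate_apply, Fin.add_def]
  · fin_cases j <;> norm_num

end Companions

end HypergeometricDarboux

end

theorem mainTheorem5 :
    -- the three functions are companions: up to power factors, they are local solutions at `z = 0`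
    -- of one and the same hypergeometric equation
    (IsHypSolutionOn ![-3 / 28, 1 / 28, 9 / 28] ![1 / 4, 1 / 2] slitDisc
        (hyp3F2 ![-3 / 28, 1 / 28, 9 / 28] ![1 / 4, 1 / 2]) ∧
      IsHypSolutionOn ![-3 / 28, 1 / 28, 9 / 28] ![1 / 4, 1 / 2] slitDisc
        (fun z => z ^ (1 / 2 : ℂ) * hyp3F2 ![11 / 28, 15 / 28, 23 / 28] ![3 / 4, 3 / 2] z) ∧
      IsHypSolutionOn ![-3 / 28, 1 / 28, 9 / 28] ![1 / 4, 1 / 2] slitDisc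
        (fun z => z ^ (3 / 4 : ℂ) * hyp3F2 ![9 / 14, 11 / 14, 15 / 14] ![5 / 4, 7 / 4] z)) ∧
    -- the three radical evaluations below concern contiguous functions
    (Contiguous ![-3 / 14, 1 / 14, 9 / 14] ![1 / 4, 3 / 4]
        ![9 / 14, 11 / 14, 15 / 14] ![5 / 4, 7 / 4] ∧
      Contiguous ![-3 / 14, 1 / 14, 9 / 14] ![1 / 4, 3 / 4]
        ![1 / 14, 9 / 14, 11 / 14] ![3 / 4, 5 / 4]) ∧
    -- the two dihedral evaluations
    (∀ᶠ x in 𝓝 (0 : ℂ),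
      hyp3F2 ![-3 / 28, 1 / 28, 9 / 28] ![1 / 4, 1 / 2] (Psi₄ x) =
        (1 / 2 * sqrtR x + 1 / 2 - 15 / 32 * x + 53 / 448 * x ^ 2 - 1 / 112 * x ^ 3) /
          (P₄ x ^ (3 / 4 : ℂ) * K₁ x)) ∧
    (∀ᶠ x in 𝓝[≠] (0 : ℂ),
      hyp3F2 ![11 / 28, 15 / 28, 23 / 28] ![3 / 4, 3 / 2] (Psi₄ x) =
        P₄ x ^ (11 / 4 : ℂ) / (Q₄ x ^ 2 * R₁ x) *
          ((sqrtR x - 1 + 15 / 16 * x - 53 / 224 * x ^ 2 + 1 / 56 * x ^ 3) /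
            (15 / 64 * x * K₂ x))) ∧
    -- the radical evaluation of the third companion
    (∀ᶠ x in 𝓝 (0 : ℂ),
      hyp3F2 ![9 / 14, 11 / 14, 15 / 14] ![5 / 4, 7 / 4] (Psi₄ x) =
        P₄ x ^ (9 / 2 : ℂ) / (Q₄ x ^ 3 * R₁ x ^ (3 / 2 : ℂ)) * (1 - 3 / 14 * x)) ∧
    -- the two further radical evaluations
    (∀ᶠ x in 𝓝 (0 : ℂ),
      hyp3F2 ![1 / 14, 9 / 14, 11 / 14] ![3 / 4, 5 / 4] (Psi₄ x) =
        P₄ x ^ (1 / 2 : ℂ) / (Q₄ x * R₁ x ^ (1 / 2 : ℂ)) *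
          (1 - 3 / 5 * x + 1 / 8 * x ^ 2 - 1 / 112 * x ^ 3)) ∧
    (∀ᶠ x in 𝓝 (0 : ℂ),
      hyp3F2 ![-3 / 14, 1 / 14, 9 / 14] ![1 / 4, 3 / 4] (Psi₄ x) =
        R₁ x ^ (1 / 2 : ℂ) / P₄ x ^ (3 / 2 : ℂ) *
          (1 - 3 / 4 * x + 1 / 4 * x ^ 2 - 3 / 112 * x ^ 3)) := by
  exact ⟨isHypSolutionOn_companions, contiguous_radical, dihedral_evaluation,
    dihedral_evaluation_companion, radical_evaluations⟩
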